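/- Let $p$ be an odd prime and let $\alpha\in\mathbb Z_p^\times=\{x\in\mathbb Z_p: p\nmid x\}$. For $x\in\mathbb Z_p$ let $\langle x\rangle_p\in\{0,1,\dots,p-1\}$ denote the least nonnegative residue of $x$ modulo $p$, put $\alpha_p^*=(\alpha+\langle-\alpha\rangle_p)/p\in\mathbb Z_p$, and let $${}_3F_2\bigg[\begin{matrix}\alpha&\alpha&\alpha\\&1&1\end{matrix}\bigg|\,1\bigg]_{p-1}=\sum_{k=0}^{p-1}\frac{(\alpha)_k^3}{(1)_k^2\,k!},\qquad (x)_k=x(x+1)\cdots(x+k-1).$$ Let $\Gamma_p:\mathbb Z_p\to\mathbb Z_p^\times$ be Morita's $p$-adic Gamma function, i.e. the continuous function with $\Gamma_p(0)=1$ and $\Gamma_p(n)=(-1)^n\prod_{1\le k<n,\ p\nmid k}k$ for all integers $n\ge1$, and let $$g_p(\alpha)=\frac{\Gamma_p(1+\frac12\alpha)\,\Gamma_p(1-\frac32\alpha)}{\Gamma_p(1+\alpha)\,\Gamma_p(1-\alpha)\,\Gamma_p(1-\frac12\alpha)^2}.$$ Then, modulo $p^3$, $${}_3F_2\bigg[\begin{matrix}\alpha&\alpha&\alpha\\&1&1\end{matrix}\bigg|\,1\bigg]_{p-1}\equiv\begin{cases}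 2g_p(\alpha)&\text{if }\langle-\alpha\rangle_p\text{ is even and }\langle-\alpha\rangle_p<\frac23p,\\ p(2-3\alpha_p^*)\,g_p(\alpha)&\text{if }\langle-\alpha\rangle_p\text{ is even and }\langle-\alpha\rangle_p\ge\frac23p,\\ p\,\alpha_p^*\,g_p(\alpha)&\text{if }\langle-\alpha\rangle_p\text{ is odd and }\langle-\alpha\rangle_p<\frac13p,\\ \frac12p^2\alpha_p^*(1-3\alpha_p^*)\,g_p(\alpha)&\text{if }\langle-\alpha\rangle_p\text{ is odd and }\langle-\alpha\rangle_p\ge\frac13p. \end{cases}$$ -/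

import Mathlib

open Filter Topology

noncomputable section

/-- The truncated hypergeometric series
`∑_{k=0}^{n} ((a₀)_k ⋯ (a_r)_k) / ((b₁)_k ⋯ (b_s)_k) * z^k / k!`
with upper parameters `a`, lower parameters `b` and argument `z`, where
`(x)_k = x (x+1) ⋯ (x+k-1)`. -/
def truncHypergeom {K : Type*} [Field K] (a b : List K) (z : K) (n : ℕ) : K :=
  ∑ k ∈ Finset.range (n + 1),
    (a.map fun x => (ascPochhammer K k).eval x).prod /
      (b.map fun x => (ascPochhammer K k).eval x).prod * (z ^ k / (k.factorial : K))

/-- Morita's `p`-adic Gamma function on the natural numbers: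
`(-1)^n` times the product of all `1 ≤ k < n` prime to `p` (so the value at `0` is `1`). -/
def padicGammaNat (p : ℕ) [Fact p.Prime] (n : ℕ) : ℤ_[p] :=
  (-1) ^ n * ∏ k ∈ (Finset.Ico 1 n).filter (fun k => ¬ p ∣ k), (k : ℤ_[p])

/-- Morita's `p`-adic Gamma function on `ℤ_p` for odd `p`: the limit of its values at natural
numbers `n` as `n` tends `p`-adically to `x`. -/
def padicGamma (p : ℕ) [Fact p.Prime] (x : ℤ_[p]) : ℤ_[p] :=
  limUnder (comap (fun n : ℕ => (n : ℤ_[p])) (𝓝 x)) (padicGammaNat p)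

/-- The least nonnegative residue of the `p`-adic integer `x` modulo `p`. -/
def leastResidue (p : ℕ) [Fact p.Prime] (x : ℤ_[p]) : ℕ :=
  (PadicInt.toZMod x).val

/-- The dash operation `(α + ⟨-α⟩_p) / p`. -/
def padicDash (p : ℕ) [Fact p.Prime] (α : ℤ_[p]) : ℚ_[p] :=
  ((α : ℚ_[p]) + (leastResidue p (-α) : ℚ_[p])) / (p : ℚ_[p])

/-- The element `1/2` of `ℤ_p`, for odd `p`. -/
def padicHalf (p : ℕ) [Fact p.Prime] : ℤ_[p] := PadicInt.inv 2

/-- `Γ_p(1+α/2) Γ_p(1-3α/2) / (Γ_p(1+α) Γ_p(1-α) Γ_p(1-α/2)^2)`. -/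
def dixonG (p : ℕ) [Fact p.Prime] (α : ℤ_[p]) : ℚ_[p] :=
  ((padicGamma p (1 + padicHalf p * α) : ℚ_[p]) *
      (padicGamma p (1 - 3 * padicHalf p * α) : ℚ_[p])) /
    ((padicGamma p (1 + α) : ℚ_[p]) * (padicGamma p (1 - α) : ℚ_[p]) *
      (padicGamma p (1 - padicHalf p * α) : ℚ_[p]) ^ 2)

/-- Congruence modulo `p ^ r`: the difference lies in `p ^ r ℤ_p`. -/
def PadicCongr (p : ℕ) [Fact p.Prime] (r : ℕ) (x y : ℚ_[p]) : Prop :=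
  ∃ c : ℤ_[p], x - y = (p : ℚ_[p]) ^ r * (c : ℚ_[p])

end

/-! Write `n = ⟨-α⟩_p` and choose natural numbers `h`, `t` with `α ≡ 2h` modulo `p ^ 3` and
`2h + n = pt`. The series is the value at `s = 0` of the well-poised series
`S(a, s²) = ∑ₖ (a)ₖ (a - s)ₖ (a + s)ₖ / (k! (1 + s)ₖ (1 - s)ₖ)` with `a = 2h`. At `s = pt` it
terminates, because `a - s = -n`, and Dixon's theorem evaluates it as a quotient of rising
factorials that the functional equation of `Γ_p` turns into an explicit multiple of
`g_p(2h) * Γ_p(1 - h)² / (Γ_p(1 - h - pt) Γ_p(1 - h + pt))`.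

Going back from `s = pt` to `s = 0` uses that, for `p ∣ s`, the increment `S(a, s²) - S(a, 0)` is
divisible by `p ^ 2` and modulo `p ^ 3` depends only on `a` modulo `p`, so that `a` may be replaced
by `-n`. If `n` is odd then `S(-n, s²) = 0`, and the quotient of `Γ_p`-values above is `1` modulo
`p ^ 2`. If `n = 2m` then `S(-n, s²)` has a closed form whose only dependence on `s` is the factor
`∏_{j = 1}^{m} (1 - s² / j²)⁻¹`, and a Wolstenholme-type congruence identifies this product at
`s = pt` with the quotient of `Γ_p`-values. -/

theorem sq_eq_one_iff_of_isUnit_two {R : Type*} [CommRing R] [IsLocalRing R]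
    (h2 : IsUnit (2 : R)) {x : R} : x ^ 2 = 1 ↔ x = 1 ∨ x = -1 := by
  refine ⟨fun hx => ?_, by rintro (rfl | rfl) <;> simp⟩
  have hprod : (x + 1) * (x - 1) = 0 := by linear_combination hx
  have hsub : IsUnit ((x + 1) + -(x - 1)) := by convert h2 using 1; ring
  rcases IsLocalRing.isUnit_or_isUnit_of_isUnit_add hsub with h | h
  · exact Or.inl (sub_eq_zero.mp (h.mul_right_eq_zero.mp hprod))
  · rw [IsUnit.neg_iff] at h
    exact Or.inr (eq_neg_of_add_eq_zero_left (h.mul_left_eq_zero.mp hprod))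

theorem prod_univ_units_eq_neg_one_of_isUnit_two {R : Type*} [CommRing R] [IsLocalRing R]
    [Fintype Rˣ] (h2 : IsUnit (2 : R)) : ∏ u : Rˣ, u = -1 := by
  classical
  have hself : ∀ u : Rˣ, u⁻¹ = u → u = 1 ∨ u = -1 := fun u hu => by
    have hsq : (u : R) ^ 2 = 1 := by
      rw [← Units.val_pow_eq_pow_val, sq, inv_eq_iff_mul_eq_one.mp hu, Units.val_one]
    exact ((sq_eq_one_iff_of_isUnit_two h2).mp hsq).imp Units.ext fun h => Units.ext h
  have hrest : ∏ u ∈ Finset.univ.erase (-1 : Rˣ), u = 1 :=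
    Finset.prod_involution (fun u _ => u⁻¹) (by simp)
      (fun u hu hu1 hinv => (hself u hinv).elim hu1 (Finset.ne_of_mem_erase hu))
      (fun u => by simp [inv_eq_iff_eq_inv]) (by simp)
  rw [← Finset.mul_prod_erase _ _ (Finset.mem_univ (-1 : Rˣ)), hrest, mul_one]

/-- The element itself if it is a unit, and `1` otherwise; `-unitPart x` is the factor by which
`Γ_p` changes from `x` to `x + 1`. -/
noncomputable def unitPart {M : Type*} [Monoid M] (x : M) : M :=
  open Classical in if IsUnit x then x else 1

theorem unitPart_of_isUnit {M : Type*} [Monoid M] {x : M} (h : IsUnit x) : unitPart x = x :=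
  if_pos h

theorem unitPart_of_not_isUnit {M : Type*} [Monoid M] {x : M} (h : ¬ IsUnit x) :
    unitPart x = 1 := if_neg h

theorem isUnit_unitPart {M : Type*} [Monoid M] (x : M) : IsUnit (unitPart x) := by
  by_cases h : IsUnit x
  · rwa [unitPart_of_isUnit h]
  · rw [unitPart_of_not_isUnit h]
    exact isUnit_one

theorem map_unitPart {M N F : Type*} [Monoid M] [Monoid N] [FunLike F M N] [MonoidHomClass F M N]
    (f : F) [IsLocalHom f] (x : M) : f (unitPart x) = unitPart (f x) := by
  by_cases h : IsUnit x
  · rw [unitPart_of_isUnit h, unitPart_of_isUnit (h.map f)]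
  · rw [unitPart_of_not_isUnit h, unitPart_of_not_isUnit (mt (isUnit_of_map_unit f x) h), map_one]

theorem prod_univ_unitPart {M : Type*} [CommMonoid M] [Fintype M] [Fintype Mˣ] :
    ∏ x : M, unitPart x = ((∏ u : Mˣ, u : Mˣ) : M) := by
  classical
  rw [Units.coe_prod]
  symm
  refine Finset.prod_of_injOn Units.val (Units.val_injective.injOn) (by simp) (fun x _ hx => ?_)
    fun u _ => (unitPart_of_isUnit u.isUnit).symm
  exact unitPart_of_not_isUnit fun h => hx ⟨h.unit, by simp⟩

@[to_additive]
theorem prod_range_natCast_zmod {M : Type*} [CommMonoid M] (N : ℕ) [NeZero N] (f : ZMod N → M) :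
    ∏ k ∈ Finset.range N, f k = ∏ x : ZMod N, f x :=
  Finset.prod_nbij' (fun k => (k : ZMod N)) ZMod.val (by simp) (by simp [ZMod.val_lt])
    (fun k hk => ZMod.val_cast_of_lt (Finset.mem_range.mp hk)) (by simp) (by simp)

section PadicIntegers

variable {p : ℕ} [Fact p.Prime]

theorem padicInt_isUnit_iff_not_dvd {x : ℤ_[p]} : IsUnit x ↔ ¬ (p : ℤ_[p]) ∣ x := by
  rw [← PadicInt.norm_lt_one_iff_dvd, ← PadicInt.not_isUnit_iff, not_not]

theorem padicInt_natCast_dvd_natCast {k : ℕ} : (p : ℤ_[p]) ∣ k ↔ p ∣ k := by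
  rw [← PadicInt.norm_lt_one_iff_dvd, PadicInt.norm_natCast_lt_one_iff]

theorem padicInt_isUnit_natCast_iff {k : ℕ} : IsUnit (k : ℤ_[p]) ↔ ¬ p ∣ k := by
  rw [padicInt_isUnit_iff_not_dvd, padicInt_natCast_dvd_natCast]

theorem padicInt_isUnit_two (hp : Odd p) : IsUnit (2 : ℤ_[p]) := by
  rw [← Nat.cast_ofNat, padicInt_isUnit_natCast_iff, Nat.prime_dvd_prime_iff_eq Fact.out
    Nat.prime_two]
  rintro rfl
  exact absurd hp (by decide)

theorem toZModPow_eq_iff_dvd_sub {N : ℕ} {x y : ℤ_[p]} :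
    PadicInt.toZModPow N x = PadicInt.toZModPow N y ↔ (p : ℤ_[p]) ^ N ∣ x - y := by
  rw [← Ideal.mem_span_singleton, ← PadicInt.ker_toZModPow, RingHom.mem_ker, map_sub, sub_eq_zero]

theorem padicInt_eq_of_forall_pow_dvd_sub {x y : ℤ_[p]} (h : ∀ N, (p : ℤ_[p]) ^ N ∣ x - y) :
    x = y :=
  PadicInt.ext_of_toZModPow.mp fun N => toZModPow_eq_iff_dvd_sub.mpr (h N)

theorem exists_natCast_pow_dvd_sub (N : ℕ) (x : ℤ_[p]) : ∃ n : ℕ, (p : ℤ_[p]) ^ N ∣ x - n :=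
  ⟨x.appr N, Ideal.mem_span_singleton.mp (PadicInt.appr_spec N x)⟩

theorem padicInt_norm_le_iff_pow_dvd {N : ℕ} {x : ℤ_[p]} :
    ‖x‖ ≤ (p : ℝ) ^ (-(N : ℤ)) ↔ (p : ℤ_[p]) ^ N ∣ x := by
  rw [PadicInt.norm_le_pow_iff_mem_span_pow, Ideal.mem_span_singleton]

theorem eventually_pow_dvd_sub (N : ℕ) (x : ℤ_[p]) : ∀ᶠ y in 𝓝 x, (p : ℤ_[p]) ^ N ∣ y - x := by
  have hpos : (0 : ℝ) < (p : ℝ) ^ (-(N : ℤ)) :=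
    zpow_pos (Nat.cast_pos.mpr (Fact.out : p.Prime).pos) _
  filter_upwards [Metric.closedBall_mem_nhds x hpos] with y hy
  rwa [Metric.mem_closedBall, dist_eq_norm, padicInt_norm_le_iff_pow_dvd] at hy

instance isLocalHom_toZModPow {N : ℕ} [NeZero N] :
    IsLocalHom (PadicInt.toZModPow (p := p) N) := by
  have : Fact (1 < p ^ N) := ⟨Nat.one_lt_pow (NeZero.ne N) (Fact.out : p.Prime).one_lt⟩
  exact .of_surjective _ (ZMod.ringHom_surjective _)

theorem prod_univ_unitPart_zmod_prime_pow (hp : Odd p) (N : ℕ) [NeZero N] :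
    ∏ x : ZMod (p ^ N), unitPart x = -1 := by
  have : Fact (1 < p ^ N) := ⟨Nat.one_lt_pow (NeZero.ne N) (Fact.out : p.Prime).one_lt⟩
  have : IsLocalRing (ZMod (p ^ N)) :=
    .of_surjective' _ (ZMod.ringHom_surjective (PadicInt.toZModPow N))
  have h2 : IsUnit (2 : ZMod (p ^ N)) :=
    map_ofNat (PadicInt.toZModPow (p := p) N) 2 ▸ (padicInt_isUnit_two hp).map _
  rw [prod_univ_unitPart, prod_univ_units_eq_neg_one_of_isUnit_two h2, Units.val_neg,
    Units.val_one]

end PadicIntegers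

section MoritaGamma

variable {p : ℕ} [Fact p.Prime]

theorem padicGammaNat_eq_prod_unitPart (n : ℕ) :
    padicGammaNat p n = ∏ k ∈ Finset.range n, -unitPart (k : ℤ_[p]) := by
  rw [Finset.prod_neg, Finset.card_range, padicGammaNat, Finset.prod_filter]
  congr 1
  rcases n with - | n
  · simp
  rw [Finset.range_eq_Ico, Finset.prod_eq_prod_Ico_succ_bot n.succ_pos, Nat.cast_zero,
    unitPart_of_not_isUnit not_isUnit_zero, one_mul]
  refine Finset.prod_congr rfl fun k _ => ?_
  simp only [unitPart, padicInt_isUnit_natCast_iff]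

theorem padicGammaNat_succ (n : ℕ) :
    padicGammaNat p (n + 1) = -unitPart (n : ℤ_[p]) * padicGammaNat p n := by
  rw [padicGammaNat_eq_prod_unitPart, padicGammaNat_eq_prod_unitPart, Finset.prod_range_succ,
    mul_comm]

theorem isUnit_padicGammaNat (n : ℕ) : IsUnit (padicGammaNat p n) := by
  rw [padicGammaNat_eq_prod_unitPart]
  exact Finset.prod_induction _ IsUnit (fun _ _ => IsUnit.mul) isUnit_one
    fun k _ => (isUnit_unitPart _).neg

theorem periodic_toZModPow_padicGammaNat (hp : Odd p) (N : ℕ) :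
    Function.Periodic (fun n => PadicInt.toZModPow N (padicGammaNat p n)) (p ^ N) := by
  intro n
  rcases eq_or_ne N 0 with rfl | hN
  · have : Subsingleton (ZMod (p ^ 0)) := by rw [pow_zero]; infer_instance
    exact Subsingleton.elim _ _
  have : NeZero N := ⟨hN⟩
  have : NeZero (p ^ N) := ⟨pow_ne_zero _ (Nat.Prime.ne_zero Fact.out)⟩
  have hprod (n : ℕ) : PadicInt.toZModPow N (padicGammaNat p n) =
      ∏ k ∈ Finset.range n, -unitPart (k : ZMod (p ^ N)) := by
    simp only [padicGammaNat_eq_prod_unitPart, map_prod, map_neg, map_unitPart, map_natCast]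
  have hblock : ∏ k ∈ Finset.range (p ^ N), -unitPart ((n + k : ℕ) : ZMod (p ^ N)) = 1 := by
    simp only [Nat.cast_add]
    rw [prod_range_natCast_zmod (p ^ N) fun x => -unitPart ((n : ZMod (p ^ N)) + x)]
    refine (Equiv.prod_comp (Equiv.addLeft (n : ZMod (p ^ N))) fun x => -unitPart x).trans ?_
    rw [Finset.prod_neg, Finset.card_univ, ZMod.card, prod_univ_unitPart_zmod_prime_pow hp,
      hp.pow.neg_one_pow, neg_one_mul, neg_neg]
  simp only [hprod, Finset.prod_range_add, hblock, mul_one]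

theorem pow_dvd_padicGammaNat_sub (hp : Odd p) {N m n : ℕ}
    (h : (p : ℤ_[p]) ^ N ∣ (m : ℤ_[p]) - n) :
    (p : ℤ_[p]) ^ N ∣ padicGammaNat p m - padicGammaNat p n := by
  rw [← toZModPow_eq_iff_dvd_sub, map_natCast, map_natCast, ZMod.natCast_eq_natCast_iff] at h
  rw [← toZModPow_eq_iff_dvd_sub, ← (periodic_toZModPow_padicGammaNat hp N).map_mod_nat m, h,
    (periodic_toZModPow_padicGammaNat hp N).map_mod_nat n]

theorem comap_natCast_nhds_neBot (x : ℤ_[p]) : NeBot (comap (fun n : ℕ => (n : ℤ_[p])) (𝓝 x)) :=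
  comap_neBot fun _ ht => PadicInt.denseRange_natCast.mem_nhds ht

theorem tendsto_padicGammaNat (hp : Odd p) (x : ℤ_[p]) :
    Tendsto (padicGammaNat p) (comap (fun n : ℕ => (n : ℤ_[p])) (𝓝 x)) (𝓝 (padicGamma p x)) := by
  have := comap_natCast_nhds_neBot x
  refine tendsto_nhds_limUnder (cauchy_map_iff_exists_tendsto.mp ?_)
  refine Metric.cauchy_iff.mpr ⟨inferInstance, fun ε hε => ?_⟩
  obtain ⟨N, hN⟩ := PadicInt.exists_pow_neg_lt p hε
  refine ⟨_, image_mem_map ((eventually_pow_dvd_sub N x).comap _), ?_⟩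
  rintro _ ⟨m, hm, rfl⟩ _ ⟨n, hn, rfl⟩
  refine lt_of_le_of_lt ?_ hN
  rw [dist_eq_norm, padicInt_norm_le_iff_pow_dvd]
  exact pow_dvd_padicGammaNat_sub hp (by simpa using dvd_sub hm hn)

theorem pow_dvd_padicGamma_sub_padicGammaNat (hp : Odd p) {N : ℕ} {x : ℤ_[p]} {n : ℕ}
    (h : (p : ℤ_[p]) ^ N ∣ x - n) : (p : ℤ_[p]) ^ N ∣ padicGamma p x - padicGammaNat p n := by
  have := comap_natCast_nhds_neBot x
  rw [← padicInt_norm_le_iff_pow_dvd]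
  refine le_of_tendsto ((tendsto_padicGammaNat hp x).sub_const (padicGammaNat p n)).norm ?_
  filter_upwards [(eventually_pow_dvd_sub N x).comap fun n : ℕ => (n : ℤ_[p])] with m hm
  rw [padicInt_norm_le_iff_pow_dvd]
  exact pow_dvd_padicGammaNat_sub hp (by simpa using dvd_add hm h)

theorem pow_dvd_padicGamma_sub (hp : Odd p) {N : ℕ} {x y : ℤ_[p]} (h : (p : ℤ_[p]) ^ N ∣ x - y) :
    (p : ℤ_[p]) ^ N ∣ padicGamma p x - padicGamma p y := by
  obtain ⟨n, hy⟩ := exists_natCast_pow_dvd_sub N y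
  have hx : (p : ℤ_[p]) ^ N ∣ x - n := by simpa using dvd_add h hy
  simpa using dvd_sub (pow_dvd_padicGamma_sub_padicGammaNat hp hx)
    (pow_dvd_padicGamma_sub_padicGammaNat hp hy)

theorem padicGamma_natCast (hp : Odd p) (n : ℕ) : padicGamma p n = padicGammaNat p n :=
  padicInt_eq_of_forall_pow_dvd_sub fun _ => pow_dvd_padicGamma_sub_padicGammaNat hp (by simp)

theorem padicGamma_zero (hp : Odd p) : padicGamma p 0 = 1 := by
  simpa [padicGammaNat] using padicGamma_natCast hp 0

theorem isUnit_padicGamma (hp : Odd p) (x : ℤ_[p]) : IsUnit (padicGamma p x) := by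
  obtain ⟨n, hn⟩ := exists_natCast_pow_dvd_sub 1 x
  have hsub := pow_dvd_padicGamma_sub_padicGammaNat hp hn
  rw [pow_one] at hsub
  rw [padicInt_isUnit_iff_not_dvd]
  intro hdvd
  exact padicInt_isUnit_iff_not_dvd.mp (isUnit_padicGammaNat n) (by simpa using dvd_sub hdvd hsub)

theorem padicGamma_add_one (hp : Odd p) (x : ℤ_[p]) :
    padicGamma p (x + 1) = -unitPart x * padicGamma p x := by
  refine PadicInt.ext_of_toZModPow.mp fun N => ?_
  rcases eq_or_ne N 0 with rfl | hN
  · have : Subsingleton (ZMod (p ^ 0)) := by rw [pow_zero]; infer_instance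
    exact Subsingleton.elim _ _
  have : NeZero N := ⟨hN⟩
  obtain ⟨n, hn⟩ := exists_natCast_pow_dvd_sub N x
  have hn' : (p : ℤ_[p]) ^ N ∣ x + 1 - (n + 1 : ℕ) := by simpa using hn
  rw [toZModPow_eq_iff_dvd_sub.mpr (pow_dvd_padicGamma_sub_padicGammaNat hp hn'),
    padicGammaNat_succ, map_mul, map_mul, map_neg, map_neg, map_unitPart, map_unitPart,
    toZModPow_eq_iff_dvd_sub.mpr hn,
    toZModPow_eq_iff_dvd_sub.mpr (pow_dvd_padicGamma_sub_padicGammaNat hp hn)]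

theorem padicGamma_add_natCast (hp : Odd p) (x : ℤ_[p]) (n : ℕ) :
    padicGamma p (x + n) =
      (-1) ^ n * (∏ j ∈ Finset.range n, unitPart (x + j)) * padicGamma p x := by
  induction n with
  | zero => simp
  | succ n ih =>
    rw [Nat.cast_succ, ← add_assoc, padicGamma_add_one hp, ih, Finset.prod_range_succ]
    ring

theorem isUnit_add_natCast_of_dvd_of_ne {x : ℤ_[p]} {i j : ℕ} (hi : i < p) (hj : j < p)
    (hij : i ≠ j) (hx : (p : ℤ_[p]) ∣ x + i) : IsUnit (x + j) := by
  rw [padicInt_isUnit_iff_not_dvd]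
  intro hxj
  have h : (p : ℤ_[p]) ^ 1 ∣ ((j : ℤ) - (i : ℤ) : ℤ) := by simpa using dvd_sub hxj hx
  rw [PadicInt.pow_p_dvd_int_iff, pow_one] at h
  have := Int.eq_zero_of_abs_lt_dvd h (by rw [abs_lt]; omega)
  omega

theorem prod_add_natCast_mul_padicGamma (hp : Odd p) {x : ℤ_[p]} {i n : ℕ} (hi : i < p)
    (hn : n ≤ p) (hx : (p : ℤ_[p]) ∣ x + i) :
    (∏ j ∈ Finset.range n, (x + j)) * padicGamma p x =
      (-1) ^ n * (if i < n then x + i else 1) * padicGamma p (x + n) := by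
  have hprod : ∏ j ∈ Finset.range n, (x + j) =
      (if i < n then x + i else 1) * ∏ j ∈ Finset.range n, unitPart (x + j) := by
    have hite : (if i < n then x + i else 1) =
        ∏ j ∈ Finset.range n, if j = i then x + (j : ℤ_[p]) else 1 := by
      simp [Finset.prod_ite_eq']
    rw [hite, ← Finset.prod_mul_distrib]
    refine Finset.prod_congr rfl fun j hj => ?_
    split_ifs with h
    · subst h
      rw [unitPart_of_not_isUnit (mt padicInt_isUnit_iff_not_dvd.mp (not_not.mpr hx)), mul_one]
    · rw [unitPart_of_isUnit (isUnit_add_natCast_of_dvd_of_ne hi (by grind) (Ne.symm h) hx),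
        one_mul]
  rw [hprod, padicGamma_add_natCast hp]
  have hsign : (-1 : ℤ_[p]) ^ n * (-1) ^ n = 1 := by rw [← mul_pow]; simp
  linear_combination (-(if i < n then x + i else 1) * (∏ j ∈ Finset.range n, unitPart (x + j)) *
    padicGamma p x) * hsign

end MoritaGamma

theorem sq_dvd_prod_add_sub {ι R : Type*} [CommRing R] (s : Finset ι) (u : ι → R) (x : R)
    (hu : ∀ i ∈ s, IsUnit (u i)) :
    x ^ 2 ∣ ∏ i ∈ s, (u i + x) - (∏ i ∈ s, u i) * (1 + x * ∑ i ∈ s, Ring.inverse (u i)) := by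
  classical
  induction s using Finset.induction_on with
  | empty => simp
  | insert a s ha ih =>
    obtain ⟨d, hd⟩ := ih fun i hi => hu i (Finset.mem_insert_of_mem hi)
    have hinv := Ring.mul_inverse_cancel _ (hu a (Finset.mem_insert_self a s))
    rw [Finset.prod_insert ha, Finset.prod_insert ha, Finset.sum_insert ha]
    refine ⟨(u a + x) * d + (∏ i ∈ s, u i) * ∑ i ∈ s, Ring.inverse (u i), ?_⟩
    linear_combination (u a + x) * hd - (∏ i ∈ s, u i) * x * hinv

theorem sum_range_inv_sq_zmod {p : ℕ} [Fact p.Prime] (hp : 3 < p) :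
    ∑ j ∈ Finset.range (p - 1), ((j : ZMod p) + 1)⁻¹ ^ 2 = 0 := by
  have hp1 : p - 1 + 1 = p := by omega
  have huniv : ∑ x : ZMod p, x⁻¹ ^ 2 = 0 := by
    rw [← FiniteField.sum_pow_lt_card_sub_one (ZMod p) 2 (by rw [ZMod.card]; omega)]
    exact Equiv.sum_comp (Equiv.inv (ZMod p)) fun x => x ^ 2
  have hrange := sum_range_natCast_zmod p fun x => x⁻¹ ^ 2
  have hsucc := Finset.sum_range_succ' (fun k : ℕ => (k : ZMod p)⁻¹ ^ 2) (p - 1)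
  rw [hp1, hrange, huniv] at hsucc
  simpa using hsucc.symm

section GammaOnMultiples

variable {p : ℕ} [Fact p.Prime]

theorem padicGamma_add_one_of_dvd (hp : Odd p) {x : ℤ_[p]} (hx : (p : ℤ_[p]) ∣ x) :
    padicGamma p (x + 1) = -padicGamma p x := by
  rw [padicGamma_add_one hp, unitPart_of_not_isUnit (by rwa [padicInt_isUnit_iff_not_dvd, not_not]),
    neg_one_mul]

theorem padicGamma_add_one_add_natCast (hp : Odd p) {m : ℕ} (hm : m < p) {x : ℤ_[p]}
    (hx : (p : ℤ_[p]) ∣ x) :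
    padicGamma p (x + 1 + m) =
      (-1) ^ (m + 1) * (∏ j ∈ Finset.range m, (x + 1 + j)) * padicGamma p x := by
  have hp1 : p - 1 + 1 = p := by have := (Fact.out : p.Prime).one_le; omega
  have hdvd : (p : ℤ_[p]) ∣ x + 1 + (p - 1 : ℕ) := by
    have hcast : ((p - 1 : ℕ) : ℤ_[p]) + 1 = p := by exact_mod_cast hp1
    rw [add_assoc, add_comm 1, hcast]
    exact dvd_add hx dvd_rfl
  have hprod := prod_add_natCast_mul_padicGamma hp (i := p - 1) (by omega) hm.le hdvd
  rw [if_neg (by omega), padicGamma_add_one_of_dvd hp hx] at hprod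
  have hsign : (-1 : ℤ_[p]) ^ m * (-1) ^ m = 1 := by rw [← mul_pow]; simp
  linear_combination -padicGamma p (x + 1 + m) * hsign - (-1) ^ m * hprod

/-- `(x + 1) ⋯ (x + p - 1)`, the factor by which `-Γ_p` changes from `x` to `x + p` when
`p ∣ x`. -/
noncomputable def blockProd (p : ℕ) [Fact p.Prime] (x : ℤ_[p]) : ℤ_[p] :=
  ∏ j ∈ Finset.range (p - 1), (x + 1 + j)

theorem padicGamma_add_prime (hp : Odd p) {x : ℤ_[p]} (hx : (p : ℤ_[p]) ∣ x) :
    padicGamma p (x + p) = -blockProd p x * padicGamma p x := by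
  have hp1 : p - 1 + 1 = p := by have := (Fact.out : p.Prime).one_le; omega
  have hcast : ((p - 1 : ℕ) : ℤ_[p]) + 1 = p := by exact_mod_cast hp1
  have h := padicGamma_add_one_add_natCast hp (m := p - 1) (by omega) hx
  rw [hp1, hp.neg_one_pow, neg_one_mul] at h
  rw [← hcast, add_comm _ (1 : ℤ_[p]), ← add_assoc, h, blockProd]

theorem isUnit_blockProd (hp : Odd p) {x : ℤ_[p]} (hx : (p : ℤ_[p]) ∣ x) :
    IsUnit (blockProd p x) := by
  have h := isUnit_padicGamma hp (x + p)
  rw [padicGamma_add_prime hp hx, neg_mul, IsUnit.neg_iff] at h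
  exact isUnit_of_mul_isUnit_left h

theorem blockProd_eq_prod_sub (x : ℤ_[p]) :
    blockProd p x = ∏ j ∈ Finset.range (p - 1), (x + p - (j + 1)) := by
  rw [blockProd, ← Finset.prod_range_reflect]
  refine Finset.prod_congr rfl fun j hj => ?_
  have hcast : ((p - 1 - 1 - j : ℕ) : ℤ_[p]) + (j + 2) = p := by
    have := Finset.mem_range.mp hj
    exact_mod_cast (by omega : p - 1 - 1 - j + (j + 2) = p)
  linear_combination hcast

theorem blockProd_neg_add_prime (hp : Odd p) (x : ℤ_[p]) :
    blockProd p (-(x + p)) = blockProd p x := by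
  have hneg : ∀ j ∈ Finset.range (p - 1), -(x + p) + p - ((j : ℤ_[p]) + 1) = -(x + 1 + j) :=
    fun j _ => by ring
  rw [blockProd_eq_prod_sub, Finset.prod_congr rfl hneg, Finset.prod_neg, Finset.card_range,
    (Nat.Odd.sub_odd hp odd_one).neg_one_pow, one_mul, blockProd]

theorem padicGamma_prime_mul_mul_padicGamma_neg (hp : Odd p) (z : ℕ) :
    padicGamma p (p * z) * padicGamma p (-(p * z)) = 1 := by
  induction z with
  | zero => simp [padicGamma_zero hp]
  | succ z ih =>
    have hpos := padicGamma_add_prime hp (x := p * (z : ℤ_[p])) (dvd_mul_right _ _)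
    have hneg := padicGamma_add_prime hp (x := -(p * (z : ℤ_[p]) + p))
      (dvd_neg.mpr (dvd_add (dvd_mul_right _ _) dvd_rfl))
    rw [blockProd_neg_add_prime hp, neg_add_rev, neg_add_cancel_comm, ← neg_add_rev] at hneg
    rw [Nat.cast_succ, mul_add_one, hpos, ← ih, hneg]
    ring

/-- The exponent `e` such that `(x + 1) ⋯ (x + p - 1)` is constant modulo `p ^ e` for
`x ∈ p ℤ_p`: it is `3` by Wolstenholme's congruence, which fails for `p = 3`. -/
def wolstenholmeExponent (p : ℕ) : ℕ := if p = 3 then 2 else 3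

theorem two_le_wolstenholmeExponent (p : ℕ) : 2 ≤ wolstenholmeExponent p := by
  unfold wolstenholmeExponent
  split_ifs <;> omega

theorem wolstenholmeExponent_le_three (p : ℕ) : wolstenholmeExponent p ≤ 3 := by
  unfold wolstenholmeExponent
  split_ifs <;> omega

theorem toZMod_eq_zero_iff_dvd {x : ℤ_[p]} : PadicInt.toZMod x = 0 ↔ (p : ℤ_[p]) ∣ x := by
  rw [← RingHom.mem_ker, PadicInt.ker_toZMod, PadicInt.maximalIdeal_eq_span_p,
    Ideal.mem_span_singleton]

theorem isUnit_succ_mul_prime_sub {j : ℕ} (hj : j + 1 < p) :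
    IsUnit (((j : ℤ_[p]) + 1) * (p - (j + 1))) := by
  have hsucc : IsUnit ((j : ℤ_[p]) + 1) := by
    rw [← Nat.cast_succ, padicInt_isUnit_natCast_iff]
    exact Nat.not_dvd_of_pos_of_lt j.succ_pos hj
  refine hsucc.mul ?_
  rw [padicInt_isUnit_iff_not_dvd] at hsucc ⊢
  rwa [dvd_sub_right dvd_rfl]

theorem prime_dvd_sum_inverse (hp : 3 < p) :
    (p : ℤ_[p]) ∣ ∑ j ∈ Finset.range (p - 1),
      Ring.inverse (((j : ℤ_[p]) + 1) * (p - (j + 1))) := by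
  rw [← toZMod_eq_zero_iff_dvd, map_sum, ← neg_zero, ← sum_range_inv_sq_zmod hp,
    ← Finset.sum_neg_distrib]
  refine Finset.sum_congr rfl fun j hj => ?_
  have hunit : IsUnit (((j : ℤ_[p]) + 1) * (p - (j + 1))) :=
    isUnit_succ_mul_prime_sub (by have := Finset.mem_range.mp hj; omega)
  have hinv := congrArg PadicInt.toZMod (Ring.mul_inverse_cancel _ hunit)
  simp only [map_mul, map_add, map_sub, map_natCast, map_one, CharP.cast_eq_zero, zero_sub] at hinv
  have hne : (j : ZMod p) + 1 ≠ 0 := fun h => by simp [h] at hinv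
  field_simp
  linear_combination -hinv

theorem blockProd_sq (z : ℤ_[p]) : blockProd p (p * z) ^ 2 =
    ∏ j ∈ Finset.range (p - 1), (((j : ℤ_[p]) + 1) * (p - (j + 1)) + p ^ 2 * (z * (z + 1))) := by
  rw [sq]
  nth_rewrite 2 [blockProd_eq_prod_sub]
  rw [blockProd, ← Finset.prod_mul_distrib]
  exact Finset.prod_congr rfl fun j _ => by ring

theorem pow_dvd_blockProd_sq_sub (hp : Odd p) (z : ℤ_[p]) :
    (p : ℤ_[p]) ^ wolstenholmeExponent p ∣ blockProd p (p * z) ^ 2 - blockProd p 0 ^ 2 := by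
  set x : ℤ_[p] := p ^ 2 * (z * (z + 1))
  set u : ℕ → ℤ_[p] := fun j => (j + 1) * (p - (j + 1))
  have hzero : blockProd p 0 ^ 2 = ∏ j ∈ Finset.range (p - 1), u j := by
    simpa using blockProd_sq (p := p) 0
  have hx : (p : ℤ_[p]) ^ 2 ∣ x := dvd_mul_right _ _
  have hquad : (p : ℤ_[p]) ^ wolstenholmeExponent p ∣ x ^ 2 :=
    (pow_dvd_pow _ ((wolstenholmeExponent_le_three p).trans (by norm_num))).trans
      ((pow_mul (p : ℤ_[p]) 2 2).symm ▸ pow_dvd_pow_of_dvd hx 2)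
  have hlin : (p : ℤ_[p]) ^ wolstenholmeExponent p ∣
      x * ∑ j ∈ Finset.range (p - 1), Ring.inverse (u j) := by
    rcases eq_or_ne p 3 with h3 | h3
    · rw [wolstenholmeExponent, if_pos h3]
      exact hx.mul_right _
    · have : p ≠ 2 := by rintro rfl; exact absurd hp (by decide)
      have := (Fact.out : p.Prime).two_le
      rw [wolstenholmeExponent, if_neg h3, pow_succ]
      exact mul_dvd_mul hx (prime_dvd_sum_inverse (by omega))
  have hexpand := hquad.trans <| sq_dvd_prod_add_sub (Finset.range (p - 1)) u x fun j hj =>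
    isUnit_succ_mul_prime_sub (by have := Finset.mem_range.mp hj; omega)
  rw [blockProd_sq, hzero]
  convert dvd_add hexpand (hlin.mul_left (∏ j ∈ Finset.range (p - 1), u j)) using 1
  ring

theorem pow_dvd_blockProd_sub (hp : Odd p) (z : ℤ_[p]) :
    (p : ℤ_[p]) ^ wolstenholmeExponent p ∣ blockProd p (p * z) - blockProd p 0 := by
  have hmod : (p : ℤ_[p]) ∣ blockProd p (p * z) - blockProd p 0 := by
    rw [← toZMod_eq_zero_iff_dvd]
    simp [blockProd]
  have hunit : IsUnit (blockProd p (p * z) + blockProd p 0) := by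
    rw [padicInt_isUnit_iff_not_dvd]
    intro hdvd
    have htwo : (p : ℤ_[p]) ∣ 2 * blockProd p 0 := by
      convert dvd_sub hdvd hmod using 1
      ring
    exact padicInt_isUnit_iff_not_dvd.mp
      ((padicInt_isUnit_two hp).mul (isUnit_blockProd hp (dvd_zero _))) htwo
  rw [← hunit.dvd_mul_left, ← sq_sub_sq]
  exact pow_dvd_blockProd_sq_sub hp z

theorem pow_dvd_padicGamma_prime_mul_add_sub (hp : Odd p) (x : ℤ_[p]) (t : ℕ) :
    (p : ℤ_[p]) ^ wolstenholmeExponent p ∣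
      padicGamma p (p * (x + t)) - (-blockProd p 0) ^ t * padicGamma p (p * x) := by
  induction t with
  | zero => simp
  | succ t ih =>
    have hstep := padicGamma_add_prime hp (x := p * (x + (t : ℤ_[p]))) (dvd_mul_right _ _)
    rw [Nat.cast_succ, ← add_assoc, mul_add_one, hstep]
    convert dvd_sub (ih.mul_left (-blockProd p 0))
      ((pow_dvd_blockProd_sub hp (x + (t : ℤ_[p]))).mul_right (padicGamma p (p * (x + t)))) using 1
    ring

theorem pow_dvd_padicGamma_mul_padicGamma_sub_sq (hp : Odd p) (y : ℤ_[p]) (t : ℕ) :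
    (p : ℤ_[p]) ^ wolstenholmeExponent p ∣
      padicGamma p (p * (y - t)) * padicGamma p (p * (y + t)) - padicGamma p (p * y) ^ 2 := by
  have hup := pow_dvd_padicGamma_prime_mul_add_sub hp y t
  have hdown := pow_dvd_padicGamma_prime_mul_add_sub hp (y - t) t
  rw [sub_add_cancel] at hdown
  convert dvd_sub (hup.mul_left (padicGamma p (p * (y - t))))
    (hdown.mul_left (padicGamma p (p * y))) using 1
  ring

end GammaOnMultiples

section DixonSum

variable {K : Type*} [Field K]

/-- `(a)_k (b)_k / ((1 + a - b)_k (1 + a + n)_k)`: the `k`-th term of the well-poised series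
`₃F₂(a, b, -n; 1 + a - b, 1 + a + n; 1)` is `(-1) ^ k * n.choose k` times this weight. -/
def dixonWeight (a b : K) (n k : ℕ) : K :=
  ∏ j ∈ Finset.range k, (a + j) * (b + j) / ((1 + a - b + j) * (1 + a + n + j))

theorem dixonWeight_succ_left (a b : K) (n k : ℕ) (h : ∀ j : ℕ, 1 + a + (j : K) ≠ 0) :
    dixonWeight a b (n + 1) k = dixonWeight a b n k * ((1 + a + n) / (1 + a + n + k)) := by
  have h' (j : ℕ) : 1 + a + (n : K) + j ≠ 0 := by
    simpa only [Nat.cast_add, ← add_assoc] using h (n + j)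
  induction k with
  | zero => simp [dixonWeight, div_self (h n)]
  | succ k ih =>
    rw [dixonWeight, Finset.prod_range_succ, ← dixonWeight, ih, dixonWeight, dixonWeight,
      Finset.prod_range_succ]
    have e0 := h' k
    have e1 := h' (k + 1)
    push_cast at e1 ⊢
    rw [show 1 + a + ((n : K) + 1) + k = 1 + a + n + (k + 1) by ring]
    by_cases hb : 1 + a - b + (k : K) = 0
    · simp [hb]
    · field_simp

/-- The `k`-th term `(a)_k (a - s)_k (a + s)_k / (k! (1 + s)_k (1 - s)_k)`, with `s ^ 2 = q`, of
the well-poised series deforming `₃F₂(a, a, a; 1, 1; 1)`. -/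
def wellPoisedTerm (a q : K) (k : ℕ) : K :=
  ∏ j ∈ Finset.range k, (a + j) * ((a + j) ^ 2 - q) / ((j + 1) * ((j + 1) ^ 2 - q))

/-- The sum of the first `N` terms of the well-poised series. -/
def wellPoisedSum (a q : K) (N : ℕ) : K :=
  ∑ k ∈ Finset.range N, wellPoisedTerm a q k

variable [CharZero K]

theorem cast_choose_succ_right (n k : ℕ) :
    (n.choose (k + 1) : K) = n.choose k * (n - k) / (k + 1) := by
  have hk : (k + 1 : K) ≠ 0 := Nat.cast_add_one_ne_zero k
  rw [eq_div_iff hk]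
  rcases le_or_gt k n with h | h
  · have := congrArg (Nat.cast : ℕ → K) (Nat.choose_succ_right_eq n k)
    push_cast [Nat.cast_sub h] at this
    exact this
  · simp [Nat.choose_eq_zero_of_lt h, Nat.choose_eq_zero_of_lt (h.trans k.lt_succ_self)]

theorem prod_range_neg_add_div (n k : ℕ) :
    ∏ j ∈ Finset.range k, (-(n : K) + j) / (j + 1) = (-1) ^ k * n.choose k := by
  induction k with
  | zero => simp
  | succ k ih =>
    rw [Finset.prod_range_succ, ih, cast_choose_succ_right]
    ring

/-- The right side vanishes at `k = n + 1`, which yields the recurrence of the Dixon sum in `n`. -/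
theorem dixonWeight_telescope (a b : K) (n k : ℕ) (h : ∀ j < k, 1 + a - b + (j : K) ≠ 0)
    (ha : ∀ j : ℕ, 1 + a + (j : K) ≠ 0) :
    ∑ i ∈ Finset.range (k + 1), (-1) ^ i * ((1 + a / 2 + n) * (1 + a - b + n) *
        (n + 1).choose i / (1 + a + n + i) - (1 + a / 2 - b + n) * n.choose i) *
          dixonWeight a b n i =
      1 / 2 * (-1) ^ k * n.choose k * dixonWeight a b n k * (a + k) * (b + k) /
        (1 + a + n + k) := by
  have ha' (j : ℕ) : 1 + a + (n : K) + j ≠ 0 := by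
    simpa only [Nat.cast_add, ← add_assoc] using ha (n + j)
  induction k with
  | zero =>
    have e0 := ha n
    simp only [dixonWeight, zero_add, Finset.range_one, Finset.sum_singleton, pow_zero,
      Nat.choose_zero_right, Nat.cast_one, Nat.cast_zero, Finset.range_zero, Finset.prod_empty,
      add_zero, mul_one, one_mul]
    field_simp
    ring
  | succ k ih =>
    rw [Finset.sum_range_succ, ih fun j hj => h j (hj.trans k.lt_succ_self),
      dixonWeight, dixonWeight, Finset.prod_range_succ, Nat.choose_succ_succ']
    push_cast
    rw [cast_choose_succ_right]
    have e1 := h k k.lt_succ_self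
    have e2 := ha' k
    have e3 := ha' (k + 1)
    have e4 : (k + 1 : K) ≠ 0 := Nat.cast_add_one_ne_zero k
    push_cast at e3
    field_simp
    ring

theorem dixonSum_succ (a b : K) (n : ℕ) (h : ∀ j ≤ n, 1 + a - b + (j : K) ≠ 0)
    (ha : ∀ j : ℕ, 1 + a + (j : K) ≠ 0) :
    (1 + a / 2 + n) * (1 + a - b + n) *
        ∑ k ∈ Finset.range (n + 2), (-1) ^ k * (n + 1).choose k * dixonWeight a b (n + 1) k =
      (1 + a + n) * (1 + a / 2 - b + n) *
        ∑ k ∈ Finset.range (n + 1), (-1) ^ k * n.choose k * dixonWeight a b n k := by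
  have htel := dixonWeight_telescope a b n (n + 1) (fun j hj => h j (Nat.le_of_lt_succ hj)) ha
  simp only [Nat.choose_succ_self, Nat.cast_zero, mul_zero, zero_mul, zero_div] at htel
  have hlast : ∑ k ∈ Finset.range (n + 1), (-1) ^ k * (n.choose k : K) * dixonWeight a b n k =
      ∑ k ∈ Finset.range (n + 2), (-1) ^ k * (n.choose k : K) * dixonWeight a b n k := by
    rw [Finset.sum_range_succ _ (n + 1), Nat.choose_succ_self]
    simp
  rw [hlast, ← sub_eq_zero, ← mul_zero (1 + a + (n : K)), ← htel, Finset.mul_sum,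
    Finset.mul_sum, Finset.mul_sum, ← Finset.sum_sub_distrib]
  refine Finset.sum_congr rfl fun k _ => ?_
  rw [dixonWeight_succ_left a b n k ha]
  ring

theorem dixon_terminating (a b : K) (n : ℕ) (h : ∀ j < n, 1 + a - b + (j : K) ≠ 0)
    (ha : ∀ j : ℕ, 1 + a + (j : K) ≠ 0) (ha₂ : ∀ j < n, 1 + a / 2 + (j : K) ≠ 0) :
    ∑ k ∈ Finset.range (n + 1), (-1) ^ k * n.choose k * dixonWeight a b n k =
      ∏ j ∈ Finset.range n, (1 + a + j) * (1 + a / 2 - b + j) /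
        ((1 + a / 2 + j) * (1 + a - b + j)) := by
  induction n with
  | zero => simp [dixonWeight]
  | succ n ih =>
    rw [Finset.prod_range_succ, ← ih (fun j hj => h j (by lia)) (fun j hj => ha₂ j (by lia)),
      mul_div_assoc', eq_div_iff (mul_ne_zero (ha₂ n n.lt_succ_self) (h n n.lt_succ_self))]
    linear_combination dixonSum_succ a b n (fun j hj => h j (Nat.lt_succ_of_le hj)) ha

/-- Dixon's sum at `b = 2 * a + n`, for which the three upper parameters are `a` and
`a ± (a + n)`. -/
theorem wellPoisedSum_add_sq (a : K) {n N : ℕ} (hN : n < N)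
    (h : ∀ j < n, 1 - a - n + (j : K) ≠ 0) (ha : ∀ j : ℕ, 1 + a + (j : K) ≠ 0)
    (ha₂ : ∀ j < n, 1 + a / 2 + (j : K) ≠ 0) :
    wellPoisedSum a ((a + n) ^ 2) N = ∏ j ∈ Finset.range n,
      (1 + a + j) * (1 - 3 * (a / 2) - n + j) / ((1 + a / 2 + j) * (1 - a - n + j)) := by
  have hterm (k : ℕ) : wellPoisedTerm a ((a + n) ^ 2) k =
      (-1) ^ k * n.choose k * dixonWeight a (2 * a + n) n k := by
    rw [← prod_range_neg_add_div, dixonWeight, ← Finset.prod_mul_distrib, wellPoisedTerm]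
    refine Finset.prod_congr rfl fun j _ => ?_
    rw [div_mul_div_comm]
    congr 1 <;> ring
  have hdixon := dixon_terminating a (2 * a + n) n
    (fun j hj => by convert h j hj using 1; ring) ha ha₂
  calc wellPoisedSum a ((a + n) ^ 2) N
      = ∑ k ∈ Finset.range (n + 1), (-1) ^ k * n.choose k * dixonWeight a (2 * a + n) n k := by
        simp only [wellPoisedSum, hterm]
        refine (Finset.sum_subset (Finset.range_mono hN) fun k _ hk => ?_).symm
        rw [Nat.choose_eq_zero_of_lt (by simpa using hk)]
        simp
    _ = _ := hdixon.trans (Finset.prod_congr rfl fun j _ => by ring_nf)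

end DixonSum

section WellPoisedSumNeg

variable {K : Type*} [Field K]

/-- `∏_{1 ≤ j ≤ k} 1 / (j (j² - q))`. -/
def cubicInvFactorial (q : K) (k : ℕ) : K :=
  ∏ j ∈ Finset.range k, 1 / (((j : K) + 1) ^ 3 - q * (j + 1))

/-- The alternating self-convolution of `cubicInvFactorial q`; it is the well-poised sum at
`a = -n` up to the factor `cubicInvFactorial q n`. -/
def cubicConvolution (q : K) (n : ℕ) : K :=
  ∑ k ∈ Finset.range (n + 1), (-1) ^ k * cubicInvFactorial q k * cubicInvFactorial q (n - k)

/-- The Wilf–Zeilberger certificate for the recurrence of `cubicConvolution`: a polynomial in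
`x = k - n / 2` with `h = n / 2`. -/
def convolutionCertificate (q h x : K) : K :=
  let c₂ := -(3 / 2) * (3 * h - 1)
  let c₁ := 3 / 2 * (3 * h - 2) * (3 * h ^ 2 + 2 * q) -
    3 / 4 * (1 - 9 * h + 12 * h ^ 2 - 2 * h ^ 3 + 2 * h * q - 4 * q)
  let c₀ := (3 * (3 * h - 1) * (3 * h - 2) * (h * (h ^ 2 - q)) -
    2 * (2 * h - 1) * ((2 * h - 1) ^ 2 - q) * (4 * h ^ 2 - q)) / 2 - c₁ / 4 - c₂ / 16
  c₀ + c₁ * x ^ 2 + c₂ * x ^ 4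

variable [CharZero K] {q : K} {m n N : ℕ}

theorem cube_sub_ne_zero {j : ℕ} (h : ((j : K) + 1) ^ 2 - q ≠ 0) :
    ((j : K) + 1) ^ 3 - q * (j + 1) ≠ 0 := by
  rw [show ((j : K) + 1) ^ 3 - q * (j + 1) = (j + 1) * ((j + 1) ^ 2 - q) by ring]
  exact mul_ne_zero (Nat.cast_add_one_ne_zero j) h

theorem cubicInvFactorial_succ_mul {j : ℕ} (h : ((j : K) + 1) ^ 2 - q ≠ 0) :
    cubicInvFactorial q (j + 1) * (((j : K) + 1) ^ 3 - q * (j + 1)) = cubicInvFactorial q j := by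
  rw [cubicInvFactorial, cubicInvFactorial, Finset.prod_range_succ, mul_assoc,
    one_div_mul_cancel (cube_sub_ne_zero h), mul_one]

theorem cubicInvFactorial_ne_zero (h : ∀ j < n, ((j : K) + 1) ^ 2 - q ≠ 0) :
    cubicInvFactorial q n ≠ 0 :=
  Finset.prod_ne_zero_iff.mpr fun j hj =>
    one_div_ne_zero (cube_sub_ne_zero (h j (Finset.mem_range.mp hj)))

theorem cubicConvolution_of_odd (q : K) (hn : Odd n) : cubicConvolution q n = 0 := by
  suffices h : cubicConvolution q n = -cubicConvolution q n from self_eq_neg.mp h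
  conv_lhs => rw [cubicConvolution, ← Finset.sum_flip]
  rw [cubicConvolution, ← Finset.sum_neg_distrib]
  refine Finset.sum_congr rfl fun k hk => ?_
  have hk : k ≤ n := Finset.mem_range_succ_iff.mp hk
  have hsign : (-1 : K) ^ (n - k) = -(-1) ^ k := by
    rcases k.even_or_odd with he | ho
    · rw [he.neg_one_pow, (Nat.Odd.sub_even hk hn he).neg_one_pow]
    · rw [ho.neg_one_pow, (Nat.Odd.sub_odd hn ho).neg_one_pow, neg_neg]
  rw [Nat.sub_sub_self hk, hsign]
  ring

theorem convolutionCertificate_spec (q h : K) {k l : K} (hkl : k + l = 2 * h) :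
    2 * (2 * h - 1) * (h * (h ^ 2 - q)) * ((2 * h - 1) ^ 2 - q) * (4 * h ^ 2 - q) -
      3 * (3 * h - 1) * (3 * h - 2) * (k ^ 3 - q * k) * (l ^ 3 - q * l) =
    -convolutionCertificate q h (k - h + 1 / 2) * (l ^ 3 - q * l) -
      convolutionCertificate q h (k - h - 1 / 2) * (k ^ 3 - q * k) := by
  obtain rfl : l = 2 * h - k := by linear_combination hkl
  simp only [convolutionCertificate]
  ring

theorem cubicConvolution_telescope (hq : ∀ j < n, ((j : K) + 1) ^ 2 - q ≠ 0) {h : K}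
    (hh : (n : K) = 2 * h) {k : ℕ} (hk : k ≤ n) :
    ∑ i ∈ Finset.range (k + 1),
      (2 * (2 * h - 1) * (h * (h ^ 2 - q)) * ((2 * h - 1) ^ 2 - q) * (4 * h ^ 2 - q) -
        3 * (3 * h - 1) * (3 * h - 2) * ((i : K) ^ 3 - q * i) *
          (((n - i : ℕ) : K) ^ 3 - q * (n - i : ℕ))) *
        ((-1) ^ i * cubicInvFactorial q i * cubicInvFactorial q (n - i)) =
      -convolutionCertificate q h (k - h + 1 / 2) *
        (((n - k : ℕ) : K) ^ 3 - q * (n - k : ℕ)) *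
        ((-1) ^ k * cubicInvFactorial q k * cubicInvFactorial q (n - k)) := by
  induction k with
  | zero =>
    rw [Finset.sum_range_one, convolutionCertificate_spec q h (by simp [hh])]
    simp
  | succ k ih =>
    rw [Finset.sum_range_succ, ih (by lia), convolutionCertificate_spec q h
      (by rw [← hh, ← Nat.cast_add, Nat.add_sub_cancel' hk])]
    obtain ⟨l, hl⟩ : ∃ l, n = k + l + 1 := ⟨n - k - 1, by lia⟩
    rw [show n - k = l + 1 by lia, show n - (k + 1) = l by lia,
      ← cubicInvFactorial_succ_mul (hq k (by lia)), ← cubicInvFactorial_succ_mul (hq l (by lia))]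
    push_cast
    rw [show (k : K) + 1 - h - 1 / 2 = k - h + 1 / 2 by ring]
    ring

theorem sum_cube_sub_mul_cubicInvFactorial (hq : ∀ j ≤ n, ((j : K) + 1) ^ 2 - q ≠ 0) :
    ∑ i ∈ Finset.range (n + 2 + 1), ((i : K) ^ 3 - q * i) *
        (((n + 2 - i : ℕ) : K) ^ 3 - q * (n + 2 - i : ℕ)) *
        ((-1) ^ i * cubicInvFactorial q i * cubicInvFactorial q (n + 2 - i)) =
      -cubicConvolution q n := by
  rw [Finset.sum_range_succ, Finset.sum_range_succ', cubicConvolution, ← Finset.sum_neg_distrib,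
    Nat.sub_self]
  simp only [Nat.cast_zero, mul_zero, ne_eq, OfNat.ofNat_ne_zero, not_false_eq_true, zero_pow,
    sub_zero, zero_mul, add_zero]
  refine Finset.sum_congr rfl fun k hk => ?_
  obtain ⟨l, rfl⟩ := Nat.exists_eq_add_of_le (Finset.mem_range_succ_iff.mp hk)
  rw [show k + l + 2 - (k + 1) = l + 1 by lia, Nat.add_sub_cancel_left,
    ← cubicInvFactorial_succ_mul (hq k (by lia)), ← cubicInvFactorial_succ_mul (hq l (by lia))]
  push_cast
  ring

theorem cubicConvolution_add_two (hq : ∀ j < n + 2, ((j : K) + 1) ^ 2 - q ≠ 0) {h : K}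
    (hh : (n : K) + 2 = 2 * h) :
    2 * (2 * h - 1) * (h * (h ^ 2 - q)) * ((2 * h - 1) ^ 2 - q) * (4 * h ^ 2 - q) *
        cubicConvolution q (n + 2) =
      -(3 * (3 * h - 1) * (3 * h - 2)) * cubicConvolution q n := by
  have htel := cubicConvolution_telescope hq (h := h) (by push_cast; exact hh) le_rfl
  rw [Nat.sub_self, Nat.cast_zero, zero_pow three_ne_zero, mul_zero, sub_zero, mul_zero,
    zero_mul] at htel
  rw [neg_mul_comm, ← sum_cube_sub_mul_cubicInvFactorial fun j hj => hq j (by lia),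
    ← sub_eq_zero, ← htel, cubicConvolution, Finset.mul_sum, Finset.mul_sum,
    ← Finset.sum_sub_distrib]
  exact Finset.sum_congr rfl fun k _ => by ring

theorem cast_factorial_three_mul_succ_div (m : ℕ) :
    ((3 * (m + 1)).factorial / (m + 1).factorial : K) =
      3 * (3 * m + 2) * (3 * m + 1) * ((3 * m).factorial / m.factorial) := by
  have hm : (m + 1 : K) ≠ 0 := Nat.cast_add_one_ne_zero m
  have hfact : (m.factorial : K) ≠ 0 := Nat.cast_ne_zero.mpr m.factorial_ne_zero
  rw [show 3 * (m + 1) = 3 * m + 2 + 1 by ring]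
  simp only [Nat.factorial_succ]
  push_cast
  field_simp
  ring

theorem cubicConvolution_two_mul (hq : ∀ j < 2 * m, ((j : K) + 1) ^ 2 - q ≠ 0) :
    cubicConvolution q (2 * m) * ∏ j ∈ Finset.range m, (((j : K) + 1) ^ 2 - q) =
      (-1) ^ m * ((3 * m).factorial / m.factorial) * cubicInvFactorial q (2 * m) := by
  induction m with
  | zero => simp [cubicConvolution, cubicInvFactorial]
  | succ m ih =>
    have ih := ih fun j hj => hq j (by lia)
    have hrec := cubicConvolution_add_two (n := 2 * m) (fun j hj => hq j (by lia))
      (h := m + 1) (by push_cast; ring)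
    have hne₁ := cube_sub_ne_zero (hq (2 * m) (by lia))
    have hne₂ := cube_sub_ne_zero (hq (2 * m + 1) (by lia))
    rw [← cubicInvFactorial_succ_mul (hq (2 * m) (by lia)),
      ← cubicInvFactorial_succ_mul (hq (2 * m + 1) (by lia))] at ih
    rw [show 2 * (m + 1) = 2 * m + 1 + 1 by ring, Finset.prod_range_succ,
      cast_factorial_three_mul_succ_div, pow_succ]
    push_cast at *
    refine mul_left_cancel₀ (mul_ne_zero hne₁ hne₂) ?_
    linear_combination (∏ j ∈ Finset.range m, (((j : K) + 1) ^ 2 - q)) * hrec -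
      3 * (3 * m + 2) * (3 * m + 1) * ih

theorem wellPoisedTerm_neg_mul (hq : ∀ j < n, ((j : K) + 1) ^ 2 - q ≠ 0) {k : ℕ} (hk : k ≤ n) :
    wellPoisedTerm (-(n : K)) q k * cubicInvFactorial q n =
      (-1) ^ k * cubicInvFactorial q k * cubicInvFactorial q (n - k) := by
  induction k with
  | zero => simp [wellPoisedTerm, cubicInvFactorial]
  | succ k ih =>
    have ih := ih (by lia)
    obtain ⟨l, rfl⟩ : ∃ l, n = k + l + 1 := ⟨n - k - 1, by lia⟩
    have hs : wellPoisedTerm (-((k + l + 1 : ℕ) : K)) q (k + 1) =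
        wellPoisedTerm (-((k + l + 1 : ℕ) : K)) q k * (-(((l : K) + 1) ^ 3 - q * (l + 1)) /
          (((k : K) + 1) ^ 3 - q * (k + 1))) := by
      rw [wellPoisedTerm, Finset.prod_range_succ, ← wellPoisedTerm]
      push_cast
      congr 2 <;> ring
    rw [show k + l + 1 - k = l + 1 by lia, ← cubicInvFactorial_succ_mul (hq k (by lia))] at ih
    rw [hs, show k + l + 1 - (k + 1) = l by lia, ← cubicInvFactorial_succ_mul (hq l (by lia)),
      mul_div_assoc', div_mul_eq_mul_div, div_eq_iff (cube_sub_ne_zero (hq k (by lia))), pow_succ]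
    linear_combination -(((l : K) + 1) ^ 3 - q * (l + 1)) * ih

theorem wellPoisedSum_neg_mul (hq : ∀ j < n, ((j : K) + 1) ^ 2 - q ≠ 0) (hN : n < N) :
    wellPoisedSum (-(n : K)) q N * cubicInvFactorial q n = cubicConvolution q n := by
  have hvanish (k : ℕ) (hk : k ∉ Finset.range (n + 1)) : wellPoisedTerm (-(n : K)) q k = 0 :=
    Finset.prod_eq_zero (Finset.mem_range.mpr (by simpa using hk)) (by simp)
  rw [wellPoisedSum, ← Finset.sum_subset (Finset.range_mono hN) fun k _ hk => hvanish k hk,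
    Finset.sum_mul, cubicConvolution]
  exact Finset.sum_congr rfl fun k hk =>
    wellPoisedTerm_neg_mul hq (Finset.mem_range_succ_iff.mp hk)

theorem wellPoisedSum_neg_of_odd (hn : Odd n) (hq : ∀ j < n, ((j : K) + 1) ^ 2 - q ≠ 0)
    (hN : n < N) : wellPoisedSum (-(n : K)) q N = 0 := by
  have h := wellPoisedSum_neg_mul hq hN
  rw [cubicConvolution_of_odd q hn] at h
  exact (mul_eq_zero.mp h).resolve_right (cubicInvFactorial_ne_zero hq)

theorem wellPoisedSum_neg_two_mul (hq : ∀ j < 2 * m, ((j : K) + 1) ^ 2 - q ≠ 0)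
    (hN : 2 * m < N) :
    wellPoisedSum (-((2 * m : ℕ) : K)) q N = (-1) ^ m * ((3 * m).factorial / m.factorial) /
      ∏ j ∈ Finset.range m, (((j : K) + 1) ^ 2 - q) := by
  have hprod : ∏ j ∈ Finset.range m, (((j : K) + 1) ^ 2 - q) ≠ 0 :=
    Finset.prod_ne_zero_iff.mpr fun j hj => hq j (by have := Finset.mem_range.mp hj; lia)
  rw [eq_div_iff hprod]
  refine mul_right_cancel₀ (cubicInvFactorial_ne_zero hq) ?_
  rw [← cubicConvolution_two_mul hq, ← wellPoisedSum_neg_mul hq hN]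
  ring

end WellPoisedSumNeg

section PadicPow

/-- The fractional ideal `p ^ r ℤ_p` of `ℚ_p`. -/
def padicPow (p : ℕ) [Fact p.Prime] (r : ℕ) : AddSubgroup ℚ_[p] where
  carrier := {x | ‖x‖ ≤ (p : ℝ) ^ (-(r : ℤ))}
  zero_mem' := by
    simp only [Set.mem_ofPred_eq, norm_zero]
    positivity
  add_mem' hx hy := (Padic.nonarchimedean _ _).trans (max_le hx hy)
  neg_mem' hx := by simpa using hx

variable {p : ℕ} [Fact p.Prime] {r s : ℕ} {x x' y y' : ℚ_[p]}

theorem mem_padicPow : x ∈ padicPow p r ↔ ‖x‖ ≤ (p : ℝ) ^ (-(r : ℤ)) := Iff.rfl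

theorem coe_mem_padicPow_iff {x : ℤ_[p]} : (x : ℚ_[p]) ∈ padicPow p r ↔ (p : ℤ_[p]) ^ r ∣ x := by
  rw [mem_padicPow, ← padicInt_norm_le_iff_pow_dvd, PadicInt.norm_def]

theorem padicCongr_iff : PadicCongr p r x y ↔ x - y ∈ padicPow p r := by
  have hp : (p : ℚ_[p]) ≠ 0 := Nat.cast_ne_zero.mpr (Fact.out : p.Prime).ne_zero
  have hp' : (p : ℝ) ≠ 0 := Nat.cast_ne_zero.mpr (Fact.out : p.Prime).ne_zero
  refine ⟨?_, fun h => ⟨⟨(x - y) / p ^ r, ?_⟩, by field_simp⟩⟩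
  · rintro ⟨c, hc⟩
    rw [hc]
    exact_mod_cast coe_mem_padicPow_iff.mpr (dvd_mul_right ((p : ℤ_[p]) ^ r) c)
  · rw [norm_div, norm_pow, Padic.norm_p, inv_pow, div_inv_eq_mul]
    calc ‖x - y‖ * (p : ℝ) ^ r ≤ (p : ℝ) ^ (-(r : ℤ)) * (p : ℝ) ^ r := by gcongr; exact h
      _ = 1 := by rw [zpow_neg, zpow_natCast]; field_simp

theorem padicPow_antitone : Antitone (padicPow p) := fun r s h x hx => by
  rw [mem_padicPow] at *
  refine hx.trans (zpow_le_zpow_right₀ ?_ (by lia))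
  exact_mod_cast (Fact.out : p.Prime).one_lt.le

theorem mem_padicPow_of_le (h : r ≤ s) (hx : x ∈ padicPow p s) : x ∈ padicPow p r :=
  padicPow_antitone h hx

theorem mul_mem_padicPow (hx : x ∈ padicPow p r) (hy : y ∈ padicPow p s) :
    x * y ∈ padicPow p (r + s) := by
  have hp : (p : ℝ) ≠ 0 := Nat.cast_ne_zero.mpr (Fact.out : p.Prime).ne_zero
  rw [mem_padicPow] at *
  rw [norm_mul, Nat.cast_add, neg_add, zpow_add₀ hp]
  exact mul_le_mul hx hy (norm_nonneg _) (by positivity)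

theorem mul_mem_padicPow_left (hx : x ∈ padicPow p r) (hy : y ∈ padicPow p 0) :
    x * y ∈ padicPow p r := mul_mem_padicPow hx hy

theorem mul_mem_padicPow_right (hx : x ∈ padicPow p 0) (hy : y ∈ padicPow p r) :
    x * y ∈ padicPow p r := by
  rw [mul_comm]
  exact mul_mem_padicPow_left hy hx

theorem mul_sub_mul_mem_padicPow (hx : x ∈ padicPow p 0) (hy' : y' ∈ padicPow p 0)
    (h : x - x' ∈ padicPow p r) (h' : y - y' ∈ padicPow p r) :
    x * y - x' * y' ∈ padicPow p r := by
  rw [show x * y - x' * y' = x * (y - y') + (x - x') * y' by ring]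
  exact add_mem (mul_mem_padicPow_right hx h') (mul_mem_padicPow_left h hy')

theorem coe_mem_padicPow_zero (x : ℤ_[p]) : (x : ℚ_[p]) ∈ padicPow p 0 :=
  coe_mem_padicPow_iff.mpr (by simp)

theorem natCast_mem_padicPow_zero (n : ℕ) : (n : ℚ_[p]) ∈ padicPow p 0 := by
  simpa using coe_mem_padicPow_zero (n : ℤ_[p])

theorem one_mem_padicPow_zero : (1 : ℚ_[p]) ∈ padicPow p 0 := by
  simpa using natCast_mem_padicPow_zero (p := p) 1

theorem natCast_mem_padicPow_one_of_dvd {n : ℕ} (h : p ∣ n) : (n : ℚ_[p]) ∈ padicPow p 1 := by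
  have := coe_mem_padicPow_iff (x := (n : ℤ_[p])) (r := 1)
  rw [pow_one, padicInt_natCast_dvd_natCast] at this
  simpa using this.mpr h

theorem inv_mem_padicPow_zero (hx : ‖x‖ = 1) : x⁻¹ ∈ padicPow p 0 := by
  simp [mem_padicPow, hx]

theorem norm_eq_one_of_sub_mem_padicPow (hy : ‖y‖ = 1) (h : x - y ∈ padicPow p 1) : ‖x‖ = 1 := by
  have hlt : ‖x - y‖ < ‖y‖ := by
    rw [mem_padicPow, Nat.cast_one, zpow_neg_one] at h
    rw [hy]
    exact h.trans_lt (inv_lt_one_of_one_lt₀ (mod_cast (Fact.out : p.Prime).one_lt))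
  rw [← sub_add_cancel x y, Padic.add_eq_max_of_ne hlt.ne, max_eq_right hlt.le, hy]

theorem inv_sub_inv_mem_padicPow (hx : ‖x‖ = 1) (hy : ‖y‖ = 1) (h : x - y ∈ padicPow p r) :
    x⁻¹ - y⁻¹ ∈ padicPow p r := by
  have hx₀ : x ≠ 0 := norm_ne_zero_iff.mp (hx ▸ one_ne_zero)
  have hy₀ : y ≠ 0 := norm_ne_zero_iff.mp (hy ▸ one_ne_zero)
  rw [show x⁻¹ - y⁻¹ = -(x - y) * (x⁻¹ * y⁻¹) by field_simp; ring]
  exact mul_mem_padicPow_left (neg_mem h)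
    (mul_mem_padicPow (inv_mem_padicPow_zero hx) (inv_mem_padicPow_zero hy))

theorem norm_natCast_eq_one_of_lt {j : ℕ} (h₀ : 0 < j) (hj : j < p) : ‖(j : ℚ_[p])‖ = 1 := by
  rw [Padic.norm_natCast_eq_one_iff, Nat.Prime.coprime_iff_not_dvd Fact.out]
  exact Nat.not_dvd_of_pos_of_lt h₀ hj

theorem norm_add_one_sq_sub_eq_one {j : ℕ} (hj : j + 1 < p) {q : ℚ_[p]} (hq : q ∈ padicPow p 2) :
    ‖((j : ℚ_[p]) + 1) ^ 2 - q‖ = 1 := by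
  have hj₁ : ‖((j : ℚ_[p]) + 1)‖ = 1 := by exact_mod_cast norm_natCast_eq_one_of_lt j.succ_pos hj
  refine norm_eq_one_of_sub_mem_padicPow (y := ((j : ℚ_[p]) + 1) ^ 2) (by simp [hj₁]) ?_
  rw [sub_sub_cancel_left]
  exact neg_mem (mem_padicPow_of_le one_le_two hq)

theorem prime_mul_mem_padicPow_one (x : ℤ_[p]) : (p : ℚ_[p]) * x ∈ padicPow p 1 := by
  have h : (p : ℤ_[p]) ^ 1 ∣ p * x := by simp
  simpa using coe_mem_padicPow_iff.mpr h

theorem sq_prime_mul_mem_padicPow (t : ℕ) : ((p : ℚ_[p]) * t) ^ 2 ∈ padicPow p 2 := by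
  have h : (p : ℚ_[p]) * t ∈ padicPow p 1 := by simpa using prime_mul_mem_padicPow_one (t : ℤ_[p])
  rw [sq]
  exact mul_mem_padicPow h h

end PadicPow

section StableIncrement

variable {p : ℕ} [Fact p.Prime] {a c q : ℚ_[p]} {F G : ℚ_[p] → ℚ_[p] → ℚ_[p]}

/-- The increments `F a q - F a 0`, for `q ∈ p² ℤ_p`, lie in `p² ℤ_p` and do not depend modulo
`p³` on `a ∈ c + p ℤ_p`. -/
structure HasStableIncrement (c : ℚ_[p]) (F : ℚ_[p] → ℚ_[p] → ℚ_[p]) : Prop where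
  center_mem : F c 0 ∈ padicPow p 0
  congr : ∀ a, a - c ∈ padicPow p 1 → F a 0 - F c 0 ∈ padicPow p 1
  incr_mem : ∀ a, a - c ∈ padicPow p 1 → ∀ q ∈ padicPow p 2, F a q - F a 0 ∈ padicPow p 2
  incr_congr : ∀ a, a - c ∈ padicPow p 1 → ∀ q ∈ padicPow p 2,
    (F a q - F a 0) - (F c q - F c 0) ∈ padicPow p 3

namespace HasStableIncrement

theorem base_mem (hF : HasStableIncrement c F) (ha : a - c ∈ padicPow p 1) :
    F a 0 ∈ padicPow p 0 := by
  rw [← sub_add_cancel (F a 0) (F c 0)]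
  exact add_mem (mem_padicPow_of_le zero_le_one (hF.congr a ha)) hF.center_mem

theorem apply_mem (hF : HasStableIncrement c F) (ha : a - c ∈ padicPow p 1)
    (hq : q ∈ padicPow p 2) : F a q ∈ padicPow p 0 := by
  rw [← sub_add_cancel (F a q) (F a 0)]
  exact add_mem (mem_padicPow_of_le (Nat.zero_le 2) (hF.incr_mem a ha q hq)) (hF.base_mem ha)

theorem apply_sub_center_mem (hF : HasStableIncrement c F) (ha : a - c ∈ padicPow p 1)
    (hq : q ∈ padicPow p 2) : F a q - F c q ∈ padicPow p 1 := by
  rw [show F a q - F c q = (F a 0 - F c 0) + ((F a q - F a 0) - (F c q - F c 0)) by ring]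
  exact add_mem (hF.congr a ha) (mem_padicPow_of_le (by lia) (hF.incr_congr a ha q hq))

theorem add (hF : HasStableIncrement c F) (hG : HasStableIncrement c G) :
    HasStableIncrement c (F + G) where
  center_mem := add_mem hF.center_mem hG.center_mem
  congr a ha := by
    simpa only [Pi.add_apply, add_sub_add_comm] using add_mem (hF.congr a ha) (hG.congr a ha)
  incr_mem a ha q hq := by
    simpa only [Pi.add_apply, add_sub_add_comm] using
      add_mem (hF.incr_mem a ha q hq) (hG.incr_mem a ha q hq)
  incr_congr a ha q hq := by
    simpa only [Pi.add_apply, add_sub_add_comm] using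
      add_mem (hF.incr_congr a ha q hq) (hG.incr_congr a ha q hq)

theorem neg (hF : HasStableIncrement c F) : HasStableIncrement c (-F) where
  center_mem := neg_mem hF.center_mem
  congr a ha := by simpa only [Pi.neg_apply, neg_sub_neg, neg_sub] using neg_mem (hF.congr a ha)
  incr_mem a ha q hq := by
    simpa only [Pi.neg_apply, neg_sub_neg, neg_sub] using neg_mem (hF.incr_mem a ha q hq)
  incr_congr a ha q hq := by
    convert neg_mem (hF.incr_congr a ha q hq) using 1
    simp only [Pi.neg_apply]
    ring

theorem mul (hF : HasStableIncrement c F) (hG : HasStableIncrement c G) :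
    HasStableIncrement c (F * G) where
  center_mem := mul_mem_padicPow hF.center_mem hG.center_mem
  congr a ha := mul_sub_mul_mem_padicPow (hF.base_mem ha) hG.center_mem (hF.congr a ha)
    (hG.congr a ha)
  incr_mem a ha q hq := mul_sub_mul_mem_padicPow (hF.apply_mem ha hq) (hG.base_mem ha)
    (hF.incr_mem a ha q hq) (hG.incr_mem a ha q hq)
  incr_congr a ha q hq := by
    have hc : c - c ∈ padicPow p 1 := by simp [zero_mem]
    simp only [Pi.mul_apply]
    rw [show F a q * G a q - F a 0 * G a 0 - (F c q * G c q - F c 0 * G c 0) =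
      F a q * ((G a q - G a 0) - (G c q - G c 0)) + (F a q - F c q) * (G c q - G c 0) +
      (((F a q - F a 0) - (F c q - F c 0)) * G a 0 + (F c q - F c 0) * (G a 0 - G c 0)) by ring]
    refine add_mem (add_mem ?_ ?_) (add_mem ?_ ?_)
    · exact mul_mem_padicPow_right (hF.apply_mem ha hq) (hG.incr_congr a ha q hq)
    · exact mul_mem_padicPow (hF.apply_sub_center_mem ha hq) (hG.incr_mem c hc q hq)
    · exact mul_mem_padicPow_left (hF.incr_congr a ha q hq) (hG.base_mem ha)
    · exact mul_mem_padicPow (hF.incr_mem c hc q hq) (hG.congr a ha)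

theorem of_forall_eq (f : ℚ_[p] → ℚ_[p]) (hc : f c ∈ padicPow p 0)
    (hf : ∀ a, a - c ∈ padicPow p 1 → f a - f c ∈ padicPow p 1) :
    HasStableIncrement c fun a _ => f a where
  center_mem := hc
  congr := hf
  incr_mem := by simp [zero_mem]
  incr_congr := by simp [zero_mem]

theorem fst (hc : c ∈ padicPow p 0) : HasStableIncrement c fun a _ => a :=
  of_forall_eq id hc fun _ ha => ha

theorem snd : HasStableIncrement c fun _ q => q where
  center_mem := zero_mem _
  congr := by simp [zero_mem]
  incr_mem := by simp
  incr_congr := by simp [zero_mem]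

end HasStableIncrement

/-- The functions with stable increments at `c` form a ring under pointwise operations. -/
def stableIncrementSubring (c : ℚ_[p]) : Subring (ℚ_[p] → ℚ_[p] → ℚ_[p]) where
  carrier := {F | HasStableIncrement c F}
  zero_mem' := .of_forall_eq 0 (zero_mem _) (by simp [zero_mem])
  one_mem' := .of_forall_eq 1 one_mem_padicPow_zero (by simp [zero_mem])
  add_mem' := .add
  mul_mem' := .mul
  neg_mem' := .neg

theorem mem_stableIncrementSubring : F ∈ stableIncrementSubring c ↔ HasStableIncrement c F :=
  Iff.rfl

theorem inv_mem_stableIncrementSubring (hF : F ∈ stableIncrementSubring c) (h : ‖F c 0‖ = 1) :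
    F⁻¹ ∈ stableIncrementSubring c := by
  rw [mem_stableIncrementSubring] at *
  have hc : c - c ∈ padicPow p 1 := by simp [zero_mem]
  have hbase (a) (ha : a - c ∈ padicPow p 1) : ‖F a 0‖ = 1 :=
    norm_eq_one_of_sub_mem_padicPow h (hF.congr a ha)
  have happly (a) (ha : a - c ∈ padicPow p 1) (q) (hq : q ∈ padicPow p 2) : ‖F a q‖ = 1 :=
    norm_eq_one_of_sub_mem_padicPow (hbase a ha)
      (mem_padicPow_of_le one_le_two (hF.incr_mem a ha q hq))
  have hincr (a) (ha : a - c ∈ padicPow p 1) (q) (hq : q ∈ padicPow p 2) :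
      F⁻¹ a q - F⁻¹ a 0 = -((F a q - F a 0) * (F a q * F a 0)⁻¹) := by
    have := norm_ne_zero_iff.mp ((happly a ha q hq).trans_ne one_ne_zero)
    have := norm_ne_zero_iff.mp ((hbase a ha).trans_ne one_ne_zero)
    simp only [Pi.inv_apply]
    field_simp
    ring
  refine ⟨inv_mem_padicPow_zero h, fun a ha => inv_sub_inv_mem_padicPow (hbase a ha) h
    (hF.congr a ha), fun a ha q hq => inv_sub_inv_mem_padicPow (happly a ha q hq) (hbase a ha)
    (hF.incr_mem a ha q hq), fun a ha q hq => ?_⟩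
  have hnorm (a) (ha : a - c ∈ padicPow p 1) : ‖F a q * F a 0‖ = 1 := by
    rw [norm_mul, happly a ha q hq, hbase a ha, one_mul]
  have hinv : (F a q * F a 0)⁻¹ - (F c q * F c 0)⁻¹ ∈ padicPow p 1 :=
    inv_sub_inv_mem_padicPow (hnorm a ha) (hnorm c hc) <|
      mul_sub_mul_mem_padicPow (hF.apply_mem ha hq) hF.center_mem
        (hF.apply_sub_center_mem ha hq) (hF.congr a ha)
  rw [hincr a ha q hq, hincr c hc q hq, neg_sub_neg, ← neg_mem_iff, neg_sub]
  rw [show ∀ u v u' v' : ℚ_[p], u * v - u' * v' = (u - u') * v + u' * (v - v') by intros; ring]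
  exact add_mem (mul_mem_padicPow_left (hF.incr_congr a ha q hq)
    (inv_mem_padicPow_zero (hnorm a ha))) (mul_mem_padicPow (hF.incr_mem c hc q hq) hinv)

theorem div_mem_stableIncrementSubring (hF : F ∈ stableIncrementSubring c)
    (hG : G ∈ stableIncrementSubring c) (h : ‖G c 0‖ = 1) :
    (fun a q => F a q / G a q) ∈ stableIncrementSubring c := by
  convert mul_mem hF (inv_mem_stableIncrementSubring hG h) using 1
  ext a q
  exact div_eq_mul_inv _ _

theorem prod_mem_stableIncrementSubring {f : ℕ → ℚ_[p] → ℚ_[p] → ℚ_[p]} {s : Finset ℕ}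
    (h : ∀ j ∈ s, f j ∈ stableIncrementSubring c) :
    (fun a q => ∏ j ∈ s, f j a q) ∈ stableIncrementSubring c := by
  convert prod_mem h using 1
  ext a q
  simp [Finset.prod_apply]

theorem hasStableIncrement_wellPoisedSum (hc : c ∈ padicPow p 0) :
    HasStableIncrement c fun a q => wellPoisedSum a q p := by
  rw [← mem_stableIncrementSubring]
  suffices hterm : ∀ k ∈ Finset.range p,
      (fun a q => wellPoisedTerm a q k) ∈ stableIncrementSubring c by
    convert sum_mem hterm using 1
    ext a q
    simp [wellPoisedSum, Finset.sum_apply]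
  intro k hk
  have hfst : (fun a _ => a) ∈ stableIncrementSubring c := HasStableIncrement.fst hc
  have hsnd : (fun _ q => q) ∈ stableIncrementSubring c := HasStableIncrement.snd
  refine prod_mem_stableIncrementSubring fun j hj => ?_
  have hjp : j + 1 < p := by grind
  have hshift := add_mem hfst (natCast_mem (stableIncrementSubring c) j)
  have hindex := add_mem (natCast_mem (stableIncrementSubring c) j) (one_mem _)
  refine div_mem_stableIncrementSubring (mul_mem hshift (sub_mem (pow_mem hshift 2) hsnd))
    (mul_mem hindex (sub_mem (pow_mem hindex 2) hsnd)) ?_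
  have hj₁ : ‖((j : ℚ_[p]) + 1)‖ = 1 := by exact_mod_cast norm_natCast_eq_one_of_lt j.succ_pos hjp
  simp [hj₁]

theorem hasStableIncrement_prod_sq_sub_div {m : ℕ} (hm : m < p) :
    HasStableIncrement (0 : ℚ_[p]) fun a q =>
      ∏ j ∈ Finset.range m, (((j : ℚ_[p]) + 1 + a) ^ 2 - q) / ((j : ℚ_[p]) + 1 + a) ^ 2 := by
  have hfst : (fun a _ => a) ∈ stableIncrementSubring (0 : ℚ_[p]) := .fst (zero_mem _)
  have hsnd : (fun _ q => q) ∈ stableIncrementSubring (0 : ℚ_[p]) := HasStableIncrement.snd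
  refine prod_mem_stableIncrementSubring fun j hj => ?_
  have hindex := add_mem (add_mem (natCast_mem (stableIncrementSubring 0) j) (one_mem _)) hfst
  refine div_mem_stableIncrementSubring (sub_mem (pow_mem hindex 2) hsnd) (pow_mem hindex 2) ?_
  simpa using norm_add_one_sq_sub_eq_one (p := p) (j := j) (by grind) (zero_mem _)

end StableIncrement

section GammaSecondRatio

variable {p : ℕ} [Fact p.Prime]

theorem norm_coe_padicGamma (hp : Odd p) (x : ℤ_[p]) : ‖(padicGamma p x : ℚ_[p])‖ = 1 :=
  PadicInt.isUnit_iff.mp (isUnit_padicGamma hp x)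

theorem coe_padicGamma_ne_zero (hp : Odd p) (x : ℤ_[p]) : (padicGamma p x : ℚ_[p]) ≠ 0 :=
  norm_ne_zero_iff.mp ((norm_coe_padicGamma hp x).trans_ne one_ne_zero)

theorem coe_prod_padicInt {ι : Type*} (s : Finset ι) (f : ι → ℤ_[p]) :
    ((∏ i ∈ s, f i : ℤ_[p]) : ℚ_[p]) = ∏ i ∈ s, (f i : ℚ_[p]) :=
  map_prod PadicInt.Coe.ringHom f s

/-- The quotient `Γ_p(v - pt) Γ_p(v + pt) / Γ_p(v)²`, a multiplicative second difference of
Morita's Gamma function. -/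
noncomputable def gammaSecondRatio (p : ℕ) [Fact p.Prime] (v : ℤ_[p]) (t : ℕ) : ℚ_[p] :=
  (padicGamma p (v - p * t) : ℚ_[p]) * (padicGamma p (v + p * t) : ℚ_[p]) /
    (padicGamma p v : ℚ_[p]) ^ 2

theorem gammaSecondRatio_prime_mul_sub_one_mem (hp : Odd p) (y : ℤ_[p]) (t : ℕ) :
    gammaSecondRatio p (p * y) t - 1 ∈ padicPow p (wolstenholmeExponent p) := by
  have h := coe_mem_padicPow_iff.mpr (pow_dvd_padicGamma_mul_padicGamma_sub_sq hp y t)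
  push_cast at h
  have hne := coe_padicGamma_ne_zero hp (p * y)
  rw [gammaSecondRatio, ← mul_sub, ← mul_add, div_sub_one (pow_ne_zero 2 hne), div_eq_mul_inv]
  exact mul_mem_padicPow_left h (inv_mem_padicPow_zero (by simp [norm_coe_padicGamma hp]))

theorem gammaSecondRatio_prime_mul_add_one_add_natCast (hp : Odd p) {m : ℕ} (hm : m < p)
    (y : ℤ_[p]) (t : ℕ) :
    gammaSecondRatio p (p * y + 1 + m) t =
      (∏ j ∈ Finset.range m, (((j : ℚ_[p]) + 1 + p * y) ^ 2 - ((p : ℚ_[p]) * t) ^ 2) /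
        ((j : ℚ_[p]) + 1 + p * y) ^ 2) * gammaSecondRatio p (p * y) t := by
  have hdvd (x : ℤ_[p]) : (p : ℤ_[p]) ∣ p * x := dvd_mul_right _ _
  have hnum : ∏ j ∈ Finset.range m, (((j : ℚ_[p]) + 1 + p * y) ^ 2 - ((p : ℚ_[p]) * t) ^ 2) =
      (∏ j ∈ Finset.range m, ((p : ℚ_[p]) * (y - t) + 1 + j)) *
        ∏ j ∈ Finset.range m, ((p : ℚ_[p]) * (y + t) + 1 + j) := by
    rw [← Finset.prod_mul_distrib]
    exact Finset.prod_congr rfl fun j _ => by ring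
  have hden : ∏ j ∈ Finset.range m, ((j : ℚ_[p]) + 1 + p * y) =
      ∏ j ∈ Finset.range m, ((p : ℚ_[p]) * y + 1 + j) :=
    Finset.prod_congr rfl fun j _ => by ring
  have hsign : ((-1 : ℚ_[p]) ^ (m + 1)) ^ 2 = 1 := by
    rw [pow_right_comm, neg_one_sq, one_pow]
  rw [gammaSecondRatio, gammaSecondRatio,
    show (p : ℤ_[p]) * y + 1 + m - p * t = p * (y - t) + 1 + m by ring,
    show (p : ℤ_[p]) * y + 1 + m + p * t = p * (y + t) + 1 + m by ring, ← mul_sub, ← mul_add,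
    padicGamma_add_one_add_natCast hp hm (hdvd _), padicGamma_add_one_add_natCast hp hm (hdvd _),
    padicGamma_add_one_add_natCast hp hm (hdvd _)]
  push_cast [coe_prod_padicInt]
  rw [Finset.prod_div_distrib, Finset.prod_pow, hnum, hden, div_mul_div_comm, mul_pow, mul_pow,
    hsign, one_mul]
  congr 1
  linear_combination (∏ j ∈ Finset.range m, ((p : ℚ_[p]) * (y - t) + 1 + j)) *
    (∏ j ∈ Finset.range m, ((p : ℚ_[p]) * (y + t) + 1 + j)) *
    (padicGamma p (p * (y - t)) : ℚ_[p]) * (padicGamma p (p * (y + t)) : ℚ_[p]) * hsign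

theorem prod_sq_div_sq_eq_one {m : ℕ} (hm : m < p) (y : ℤ_[p]) :
    ∏ j ∈ Finset.range m, (((j : ℚ_[p]) + 1 + p * y) ^ 2 - 0) / ((j : ℚ_[p]) + 1 + p * y) ^ 2 =
      1 := by
  refine Finset.prod_eq_one fun j hj => ?_
  have hj₁ : ‖(j : ℚ_[p]) + 1‖ = 1 := by
    exact_mod_cast norm_natCast_eq_one_of_lt j.succ_pos (by grind)
  have hnorm : ‖(j : ℚ_[p]) + 1 + p * y‖ = 1 := norm_eq_one_of_sub_mem_padicPow hj₁ <| by
    simpa using prime_mul_mem_padicPow_one y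
  rw [sub_zero, div_self (pow_ne_zero 2 (norm_ne_zero_iff.mp (hnorm.trans_ne one_ne_zero)))]

theorem gammaSecondRatio_sub_prod_mem (hp : Odd p) {m : ℕ} (hm : m < p) (y : ℤ_[p]) (t : ℕ) :
    gammaSecondRatio p (p * y + 1 + m) t -
        ∏ j ∈ Finset.range m, (((j : ℚ_[p]) + 1) ^ 2 - ((p : ℚ_[p]) * t) ^ 2) /
          ((j : ℚ_[p]) + 1) ^ 2 ∈ padicPow p (wolstenholmeExponent p) := by
  have hstable := hasStableIncrement_prod_sq_sub_div hm
  have hy : (p : ℚ_[p]) * y - 0 ∈ padicPow p 1 := by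
    simpa using prime_mul_mem_padicPow_one y
  have hq := sq_prime_mul_mem_padicPow (p := p) t
  have hincr := hstable.incr_congr _ hy _ hq
  have hone₀ := prod_sq_div_sq_eq_one hm (0 : ℤ_[p])
  simp only [PadicInt.coe_zero, mul_zero] at hone₀
  rw [prod_sq_div_sq_eq_one hm, hone₀, sub_sub_sub_cancel_right] at hincr
  have hdiff := add_mem (mul_mem_padicPow_right (hstable.apply_mem hy hq)
    (gammaSecondRatio_prime_mul_sub_one_mem hp y t))
    (mem_padicPow_of_le (wolstenholmeExponent_le_three p) hincr)
  rw [gammaSecondRatio_prime_mul_add_one_add_natCast hp hm]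
  simp only [add_zero] at hdiff
  convert hdiff using 1
  ring

theorem gammaSecondRatio_sub_one_mem (hp : Odd p) {m : ℕ} (hm : m < p) (y : ℤ_[p]) (t : ℕ) :
    gammaSecondRatio p (p * y + 1 + m) t - 1 ∈ padicPow p 2 := by
  have hone := prod_sq_div_sq_eq_one hm (0 : ℤ_[p])
  simp only [PadicInt.coe_zero, mul_zero] at hone
  have hincr := (hasStableIncrement_prod_sq_sub_div hm).incr_mem 0 (by simp [zero_mem]) _
    (sq_prime_mul_mem_padicPow t)
  rw [hone] at hincr
  simp only [add_zero] at hincr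
  rw [← sub_add_sub_cancel]
  exact add_mem (mem_padicPow_of_le (two_le_wolstenholmeExponent p)
    (gammaSecondRatio_sub_prod_mem hp hm y t)) hincr

end GammaSecondRatio

section Deformation

variable {p : ℕ} [Fact p.Prime] {m n : ℕ} {a q w : ℚ_[p]}

theorem neg_natCast_mem_padicPow_zero (n : ℕ) : -(n : ℚ_[p]) ∈ padicPow p 0 :=
  neg_mem (natCast_mem_padicPow_zero n)

theorem wellPoisedSum_mul_sub_mem_of_odd (hn : Odd n) (hnp : n < p)
    (ha : a + n ∈ padicPow p 1) (hq : q ∈ padicPow p 2) (hw : w - 1 ∈ padicPow p 2) :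
    wellPoisedSum a q p * w - wellPoisedSum a 0 p ∈ padicPow p 3 := by
  have hstable := hasStableIncrement_wellPoisedSum (neg_natCast_mem_padicPow_zero (p := p) n)
  have ha' : a - -(n : ℚ_[p]) ∈ padicPow p 1 := by rwa [sub_neg_eq_add]
  have hvanish (q : ℚ_[p]) (hq : q ∈ padicPow p 2) : wellPoisedSum (-(n : ℚ_[p])) q p = 0 := by
    refine wellPoisedSum_neg_of_odd hn (fun j hj => ?_) hnp
    exact norm_ne_zero_iff.mp ((norm_add_one_sq_sub_eq_one (by lia) hq).trans_ne one_ne_zero)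
  have hincr := hstable.incr_congr a ha' q hq
  have happly := hstable.apply_sub_center_mem ha' hq
  rw [hvanish q hq, hvanish 0 (zero_mem _), sub_zero, sub_zero] at hincr
  rw [hvanish q hq, sub_zero] at happly
  convert add_mem (mul_mem_padicPow happly hw) hincr using 1
  ring

theorem wellPoisedSum_neg_two_mul_mul_prod (hm : 2 * m < p) (hq : q ∈ padicPow p 2) :
    wellPoisedSum (-((2 * m : ℕ) : ℚ_[p])) q p *
        ∏ j ∈ Finset.range m, (((j : ℚ_[p]) + 1) ^ 2 - q) / ((j : ℚ_[p]) + 1) ^ 2 =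
      wellPoisedSum (-((2 * m : ℕ) : ℚ_[p])) 0 p := by
  have hne (q : ℚ_[p]) (hq : q ∈ padicPow p 2) (j : ℕ) (hj : j < 2 * m) :
      ((j : ℚ_[p]) + 1) ^ 2 - q ≠ 0 :=
    norm_ne_zero_iff.mp ((norm_add_one_sq_sub_eq_one (by lia) hq).trans_ne one_ne_zero)
  have hprod : ∏ j ∈ Finset.range m, (((j : ℚ_[p]) + 1) ^ 2 - q) ≠ 0 :=
    Finset.prod_ne_zero_iff.mpr fun j hj => hne q hq j (by grind)
  rw [wellPoisedSum_neg_two_mul (hne q hq) hm, wellPoisedSum_neg_two_mul (hne 0 (zero_mem _)) hm,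
    Finset.prod_div_distrib, div_mul_div_cancel₀ hprod]
  simp only [sub_zero]

/- For `p = 3` the factor `(3m)! / m!` of the closed form makes up for the weaker congruence of
the Gamma quotients. -/
theorem wellPoisedSum_neg_two_mul_mem (hm₀ : 0 < m) (hm : 2 * m < p) (hq : q ∈ padicPow p 2) :
    wellPoisedSum (-((2 * m : ℕ) : ℚ_[p])) q p ∈ padicPow p (3 - wolstenholmeExponent p) := by
  by_cases hp : p = 3
  · subst hp
    obtain rfl : m = 1 := by lia
    have hnorm (j : ℕ) (hj : j < 2) : ‖((j : ℚ_[3]) + 1) ^ 2 - q‖ = 1 :=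
      norm_add_one_sq_sub_eq_one (by lia) hq
    have hfac : ((-1) ^ 1 * ((3 * 1).factorial / Nat.factorial 1) : ℚ_[3]) = -(6 : ℕ) := by
      norm_num [Nat.factorial]
    rw [wellPoisedSum_neg_two_mul
      (fun j hj => norm_ne_zero_iff.mp ((hnorm j hj).trans_ne one_ne_zero)) hm, hfac,
      Finset.prod_range_one, div_eq_mul_inv]
    exact mul_mem_padicPow_left (neg_mem (natCast_mem_padicPow_one_of_dvd (by norm_num)))
      (inv_mem_padicPow_zero (hnorm 0 two_pos))
  · rw [wolstenholmeExponent, if_neg hp]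
    refine (hasStableIncrement_wellPoisedSum
      (neg_natCast_mem_padicPow_zero (2 * m))).apply_mem ?_ hq
    rw [sub_self]
    exact zero_mem _

theorem wellPoisedSum_mul_gammaSecondRatio_sub_mem (hp : Odd p) (hm₀ : 0 < m) (hm : 2 * m < p)
    (ha : a + (2 * m : ℕ) ∈ padicPow p 1) (y : ℤ_[p]) (t : ℕ) :
    wellPoisedSum a (((p : ℚ_[p]) * t) ^ 2) p * gammaSecondRatio p (p * y + 1 + m) t -
      wellPoisedSum a 0 p ∈ padicPow p 3 := by
  have hstable := hasStableIncrement_wellPoisedSum (neg_natCast_mem_padicPow_zero (p := p) (2 * m))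
  have ha' : a - -((2 * m : ℕ) : ℚ_[p]) ∈ padicPow p 1 := by rwa [sub_neg_eq_add]
  have hq := sq_prime_mul_mem_padicPow (p := p) t
  have hmp : m < p := by lia
  have hcenter := mul_mem_padicPow (wellPoisedSum_neg_two_mul_mem hm₀ hm hq)
    (gammaSecondRatio_sub_prod_mem hp hmp y t)
  rw [Nat.sub_add_cancel (wolstenholmeExponent_le_three p), mul_sub,
    wellPoisedSum_neg_two_mul_mul_prod hm hq] at hcenter
  convert add_mem (add_mem (hstable.incr_congr a ha' _ hq) (mul_mem_padicPow
    (hstable.apply_sub_center_mem ha' hq) (gammaSecondRatio_sub_one_mem hp hmp y t))) hcenter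
    using 1
  ring

end Deformation

section DixonEvaluation

variable {p : ℕ} [Fact p.Prime]

theorem two_mul_padicHalf (hp : Odd p) : 2 * padicHalf p = 1 :=
  PadicInt.mul_inv (PadicInt.isUnit_iff.mp (padicInt_isUnit_two hp))

theorem dixonG_two_mul (hp : Odd p) (x : ℤ_[p]) : dixonG p (2 * x) =
    ((padicGamma p (1 + x) : ℚ_[p]) * (padicGamma p (1 - 3 * x) : ℚ_[p])) /
      ((padicGamma p (1 + 2 * x) : ℚ_[p]) * (padicGamma p (1 - 2 * x) : ℚ_[p]) *
        (padicGamma p (1 - x) : ℚ_[p]) ^ 2) := by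
  have h := two_mul_padicHalf hp
  rw [dixonG, show padicHalf p * (2 * x) = x by linear_combination x * h,
    show 3 * padicHalf p * (2 * x) = 3 * x by linear_combination 3 * x * h]

theorem coe_padicGamma_one_add_mul_one_sub (hp : Odd p) (t : ℕ) :
    (padicGamma p (1 + p * t) : ℚ_[p]) * (padicGamma p (1 - p * t) : ℚ_[p]) = 1 := by
  have h := padicGamma_prime_mul_mul_padicGamma_neg hp t
  rw [← neg_mul_neg, ← padicGamma_add_one_of_dvd hp (dvd_mul_right _ _),
    ← padicGamma_add_one_of_dvd hp (dvd_neg.mpr (dvd_mul_right _ _)), add_comm,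
    neg_add_eq_sub] at h
  exact_mod_cast congrArg ((↑) : ℤ_[p] → ℚ_[p]) h

theorem prod_add_natCast_eq_div_padicGamma (hp : Odd p) {x y z : ℤ_[p]} {u : ℚ_[p]} {i n : ℕ}
    (hi₀ : 0 < i) (hi : i ≤ p) (hn : n ≤ p) (hu : u = x) (hy : x + i = p * y + 1)
    (hz : x + n = z) :
    ∏ j ∈ Finset.range n, (u + j) = (-1) ^ n * (if i ≤ n then (p * y : ℚ_[p]) else 1) *
      (padicGamma p z : ℚ_[p]) / (padicGamma p x : ℚ_[p]) := by
  obtain ⟨k, rfl⟩ := Nat.exists_eq_add_one.mpr hi₀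
  have hk : x + k = p * y := by
    push_cast at hy
    linear_combination hy
  have h := congrArg ((↑) : ℤ_[p] → ℚ_[p]) (prod_add_natCast_mul_padicGamma hp hi hn ⟨y, hk⟩)
  rw [hk, hz] at h
  rw [eq_div_iff (coe_padicGamma_ne_zero hp x), hu]
  simp only [Nat.succ_le_iff]
  split_ifs at h ⊢ <;> simpa [coe_prod_padicInt] using h

variable {h m n t τ : ℕ}

theorem wellPoisedSum_two_mul (hn₀ : 0 < n) (hn : n < p) (hh : 2 * h + n = p * t) :
    wellPoisedSum (2 * h : ℚ_[p]) ((p * t) ^ 2) p =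
      (∏ j ∈ Finset.range n, (1 + 2 * h + j : ℚ_[p])) *
          (∏ j ∈ Finset.range n, (1 - 3 * h - n + j : ℚ_[p])) /
        ((∏ j ∈ Finset.range n, (1 + h + j : ℚ_[p])) *
          ∏ j ∈ Finset.range n, (1 - 2 * h - n + j : ℚ_[p])) := by
  have hh' : (2 * h + n : ℚ_[p]) = p * t := by exact_mod_cast hh
  have hh₀ : h ≠ 0 := by
    rintro rfl
    exact Nat.not_dvd_of_pos_of_lt hn₀ hn (by simpa using Dvd.intro t hh.symm)
  have half : (2 * h / 2 : ℚ_[p]) = h := mul_div_cancel_left₀ _ two_ne_zero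
  rw [← hh', wellPoisedSum_add_sq _ hn, half, Finset.prod_div_distrib, Finset.prod_mul_distrib,
    Finset.prod_mul_distrib]
  · intro j hj
    obtain ⟨k, rfl⟩ : ∃ k, n = j + 1 + k := ⟨n - (j + 1), by lia⟩
    rw [show 1 - 2 * (h : ℚ_[p]) - (j + 1 + k : ℕ) + j = -(2 * h + k : ℕ) by push_cast; ring]
    exact neg_ne_zero.mpr (Nat.cast_ne_zero.mpr (by lia))
  · exact fun j => by exact_mod_cast (by lia : 1 + 2 * h + j ≠ 0)
  · rw [half]
    exact fun j _ => by exact_mod_cast (by lia : 1 + h + j ≠ 0)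

theorem wellPoisedSum_mul_gammaSecondRatio (hp : Odd p) (hn₀ : 0 < n) (hn : n < p)
    (hh : 2 * h + n = p * t) (hm₀ : 0 < m) (hmp : m < p) (hm : h + m = p * τ) :
    wellPoisedSum (2 * h : ℚ_[p]) ((p * t) ^ 2) p * gammaSecondRatio p (1 - h) t =
      p * t * (if p ≤ m + n then (p * (1 - t - τ) : ℚ_[p]) else 1) /
        (if m ≤ n then (p * τ : ℚ_[p]) else 1) * dixonG p (2 * h) := by
  have hh' : (2 * h + n : ℤ_[p]) = p * t := by exact_mod_cast hh
  have hm' : (h + m : ℤ_[p]) = p * τ := by exact_mod_cast hm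
  have hh'' : (2 * h + n : ℚ_[p]) = p * t := by exact_mod_cast hh
  have hA := prod_add_natCast_eq_div_padicGamma hp (x := 1 + 2 * h) (y := t) (z := 1 + p * t)
    (u := 1 + 2 * h) hn₀ hn.le hn.le (by norm_cast) (by linear_combination hh')
    (by linear_combination hh')
  have hB := prod_add_natCast_eq_div_padicGamma hp (x := 1 - h - p * t) (y := 1 - t - τ)
    (z := 1 - 3 * h) (u := 1 - 3 * h - n) (i := p - m) (by lia) (by lia) hn.le
    (by push_cast; linear_combination -hh'')
    (by rw [Nat.cast_sub hmp.le]; linear_combination -hm') (by linear_combination hh')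
  have hC := prod_add_natCast_eq_div_padicGamma hp (x := 1 + h) (y := τ) (z := 1 - h + p * t)
    (u := 1 + h) hm₀ hmp.le hn.le (by norm_cast) (by linear_combination hm')
    (by linear_combination hh')
  have hD := prod_add_natCast_eq_div_padicGamma hp (x := 1 - p * t) (y := 1 - t)
    (z := 1 - 2 * h) (u := 1 - 2 * h - n) hn.pos le_rfl hn.le
    (by push_cast; linear_combination -hh'')
    (by ring) (by linear_combination hh')
  have hne := coe_padicGamma_ne_zero hp
  have hreflect := eq_inv_of_mul_eq_one_right (coe_padicGamma_one_add_mul_one_sub hp t)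
  have hden : (if m ≤ n then (p * τ : ℚ_[p]) else 1) ≠ 0 := by
    split_ifs
    · exact_mod_cast (by lia : p * τ ≠ 0)
    · exact one_ne_zero
  rw [gammaSecondRatio, dixonG_two_mul hp, wellPoisedSum_two_mul hn₀ hn hh, hA, hB, hC, hD]
  simp only [le_refl, if_true, hn.not_ge, if_false, hreflect, tsub_le_iff_left]
  push_cast
  field_simp [hne]

end DixonEvaluation

theorem exists_eq_mul_of_odd_of_two_mul_eq {d k t : ℕ} (hd : Odd d) (h : 2 * k = d * t) :
    ∃ τ, k = d * τ :=
  (Nat.coprime_two_right.mpr hd).dvd_of_dvd_mul_left (h ▸ dvd_mul_right d t)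

section NaturalParameter

variable {p : ℕ} [Fact p.Prime] {h m n t τ : ℕ}

theorem two_mul_add_natCast_mem_padicPow_one (hh : 2 * h + n = p * t) :
    (2 * h + n : ℚ_[p]) ∈ padicPow p 1 := by
  exact_mod_cast natCast_mem_padicPow_one_of_dvd (Dvd.intro t hh.symm)

theorem prime_mul_neg_add_one_add_natCast (hτ : h + m = p * τ) :
    (p : ℤ_[p]) * -τ + 1 + m = 1 - h := by
  have hτ' : (h + m : ℤ_[p]) = p * τ := by exact_mod_cast hτ
  linear_combination hτ'

theorem wellPoisedSum_two_mul_sub_mem_of_even (hp : Odd p) (hm₀ : 0 < m) (hm : 2 * m < p)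
    (hh : 2 * h + 2 * m = p * t) :
    wellPoisedSum (2 * h : ℚ_[p]) 0 p -
      (if p ≤ 3 * m then (p * (2 - 3 * t) : ℚ_[p]) else 2) * dixonG p (2 * h) ∈ padicPow p 3 := by
  obtain ⟨τ, hτ⟩ := exists_eq_mul_of_odd_of_two_mul_eq hp (by rwa [mul_add] : 2 * (h + m) = _)
  have hp₀ : (p : ℚ_[p]) ≠ 0 := Nat.cast_ne_zero.mpr (Fact.out : p.Prime).ne_zero
  have hτ₀ : (τ : ℚ_[p]) ≠ 0 := Nat.cast_ne_zero.mpr (by rintro rfl; lia)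
  obtain rfl : t = 2 * τ := Nat.eq_of_mul_eq_mul_left (Fact.out : p.Prime).pos (by lia)
  have hdeform := wellPoisedSum_mul_gammaSecondRatio_sub_mem hp hm₀ hm
    (two_mul_add_natCast_mem_padicPow_one hh) (-τ) (2 * τ)
  rw [prime_mul_neg_add_one_add_natCast hτ, wellPoisedSum_mul_gammaSecondRatio hp (by lia) hm hh
    hm₀ (by lia) hτ, if_pos (by lia : m ≤ 2 * m), ← neg_mem_iff, neg_sub] at hdeform
  convert hdeform using 3
  rw [show m + 2 * m = 3 * m by ring]
  push_cast
  split_ifs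
  · field_simp
    ring
  · field_simp

theorem wellPoisedSum_two_mul_sub_mem_of_odd (hp : Odd p) (hn : Odd n) (hnp : n < p)
    (hh : 2 * h + n = p * t) :
    wellPoisedSum (2 * h : ℚ_[p]) 0 p -
      (if p ≤ 3 * n then (1 / 2 * p ^ 2 * t * (1 - 3 * t) : ℚ_[p]) else p * t) *
        dixonG p (2 * h) ∈ padicPow p 3 := by
  obtain ⟨m, hm⟩ := hn.add_odd hp
  obtain ⟨τ, hτ⟩ := exists_eq_mul_of_odd_of_two_mul_eq (k := h + m) (t := t + 1) hp
    (by rw [mul_add_one]; lia)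
  have ht : t + 1 = 2 * τ := Nat.eq_of_mul_eq_mul_left (Fact.out : p.Prime).pos
    (by rw [mul_add_one]; lia)
  have ht' : (t + 1 : ℚ_[p]) = 2 * τ := by exact_mod_cast ht
  have hdeform := wellPoisedSum_mul_sub_mem_of_odd hn hnp (two_mul_add_natCast_mem_padicPow_one hh)
    (sq_prime_mul_mem_padicPow t) (gammaSecondRatio_sub_one_mem hp (by lia : m < p) (-τ) t)
  rw [prime_mul_neg_add_one_add_natCast hτ, wellPoisedSum_mul_gammaSecondRatio hp hn.pos hnp hh
    (by lia) (by lia) hτ, if_neg (by lia : ¬ m ≤ n), ← neg_mem_iff, neg_sub] at hdeform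
  convert hdeform using 3
  rw [div_one, if_congr (by lia : p ≤ m + n ↔ p ≤ 3 * n) rfl rfl]
  split_ifs
  · linear_combination -(1 / 2) * (p : ℚ_[p]) ^ 2 * t * ht'
  · rw [mul_one]

end NaturalParameter

section Transfer

theorem truncHypergeom_eq_wellPoisedSum {K : Type*} [Field K] (a : K) (N : ℕ) :
    truncHypergeom [a, a, a] [1, 1] 1 N = wellPoisedSum a 0 (N + 1) := by
  have hasc (k : ℕ) : (ascPochhammer K k).eval a = ∏ j ∈ Finset.range k, (a + j) := by
    induction k with
    | zero => simp
    | succ k ih => rw [ascPochhammer_succ_eval, ih, Finset.prod_range_succ]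
  have hfac (k : ℕ) : (k.factorial : K) = ∏ j ∈ Finset.range k, ((j : K) + 1) := by
    rw [← Finset.prod_range_add_one_eq_factorial]
    push_cast
    rfl
  refine Finset.sum_congr rfl fun k _ => ?_
  simp only [List.map_cons, List.map_nil, List.prod_cons, List.prod_nil, mul_one, one_pow,
    ascPochhammer_eval_one, hasc, hfac, sub_zero, wellPoisedTerm, Finset.prod_div_distrib,
    Finset.prod_mul_distrib, Finset.prod_pow]
  rw [div_mul_div_comm, mul_one]
  ring

variable {p : ℕ} [Fact p.Prime] {r : ℕ} {x y : ℤ_[p]}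

theorem coe_eval_ascPochhammer (k : ℕ) (x : ℤ_[p]) :
    (((ascPochhammer ℤ_[p] k).eval x : ℤ_[p]) : ℚ_[p]) =
      (ascPochhammer ℚ_[p] k).eval (x : ℚ_[p]) := by
  rw [← ascPochhammer_map PadicInt.Coe.ringHom, Polynomial.eval_map]
  exact (Polynomial.eval₂_at_apply PadicInt.Coe.ringHom x).symm

theorem norm_factorial_eq_one_of_lt {k : ℕ} (hk : k < p) : ‖(k.factorial : ℚ_[p])‖ = 1 := by
  rw [Padic.norm_natCast_eq_one_iff, Nat.Prime.coprime_iff_not_dvd Fact.out,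
    (Fact.out : p.Prime).dvd_factorial]
  exact hk.not_ge

theorem truncHypergeom_sub_mem (h : (p : ℤ_[p]) ^ r ∣ x - y) :
    truncHypergeom [(x : ℚ_[p]), (x : ℚ_[p]), (x : ℚ_[p])] [1, 1] 1 (p - 1) -
      truncHypergeom [(y : ℚ_[p]), (y : ℚ_[p]), (y : ℚ_[p])] [1, 1] 1 (p - 1) ∈ padicPow p r := by
  rw [truncHypergeom, truncHypergeom, Nat.sub_add_cancel (Fact.out : p.Prime).one_le,
    ← Finset.sum_sub_distrib]
  refine sum_mem fun k hk => ?_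
  have hfac := norm_factorial_eq_one_of_lt (Finset.mem_range.mp hk)
  have hpoly := coe_mem_padicPow_iff.mpr
    (h.trans (Polynomial.sub_dvd_eval_sub x y (ascPochhammer ℤ_[p] k ^ 3)))
  simp only [Polynomial.eval_pow, PadicInt.coe_sub, PadicInt.coe_pow, coe_eval_ascPochhammer]
    at hpoly
  convert mul_mem_padicPow_left hpoly
    (inv_mem_padicPow_zero (x := (k.factorial : ℚ_[p]) ^ 3) (by simp [hfac])) using 1
  simp only [List.map_cons, List.map_nil, List.prod_cons, List.prod_nil, ascPochhammer_eval_one]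
  ring

theorem dixonG_mem_padicPow_zero (hp : Odd p) (x : ℤ_[p]) : dixonG p x ∈ padicPow p 0 := by
  simp [mem_padicPow, dixonG, norm_coe_padicGamma hp]

theorem dixonG_sub_mem (hp : Odd p) (h : (p : ℤ_[p]) ^ r ∣ x - y) :
    dixonG p x - dixonG p y ∈ padicPow p r := by
  have hint (u : ℤ_[p]) := coe_mem_padicPow_zero (padicGamma p u)
  have hΓ {u v : ℤ_[p]} (c : ℤ_[p]) (huv : u - v = c * (x - y)) :
      (padicGamma p u : ℚ_[p]) - padicGamma p v ∈ padicPow p r := by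
    exact_mod_cast coe_mem_padicPow_iff.mpr
      (pow_dvd_padicGamma_sub hp (huv ▸ dvd_mul_of_dvd_right h c))
  rw [dixonG, dixonG, div_eq_mul_inv, div_eq_mul_inv, sq, sq]
  refine mul_sub_mul_mem_padicPow (mul_mem_padicPow (hint _) (hint _))
    (inv_mem_padicPow_zero (by simp [norm_coe_padicGamma hp]))
    (mul_sub_mul_mem_padicPow (hint _) (hint _) (hΓ (padicHalf p) (by ring))
      (hΓ (-3 * padicHalf p) (by ring)))
    (inv_sub_inv_mem_padicPow (by simp [norm_coe_padicGamma hp])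
      (by simp [norm_coe_padicGamma hp]) ?_)
  exact mul_sub_mul_mem_padicPow (mul_mem_padicPow (hint _) (hint _))
    (mul_mem_padicPow (hint _) (hint _))
    (mul_sub_mul_mem_padicPow (hint _) (hint _) (hΓ 1 (by ring)) (hΓ (-1) (by ring)))
    (mul_sub_mul_mem_padicPow (hint _) (hint _) (hΓ (-padicHalf p) (by ring))
      (hΓ (-padicHalf p) (by ring)))

theorem dvd_add_leastResidue_neg (x : ℤ_[p]) : (p : ℤ_[p]) ∣ x + leastResidue p (-x) := by
  rw [← toZMod_eq_zero_iff_dvd, leastResidue]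
  simp

theorem leastResidue_lt (x : ℤ_[p]) : leastResidue p x < p := ZMod.val_lt _

theorem leastResidue_neg_pos (hx : IsUnit x) : 0 < leastResidue p (-x) := by
  refine Nat.pos_of_ne_zero fun h => padicInt_isUnit_iff_not_dvd.mp hx ?_
  simpa [h] using dvd_add_leastResidue_neg x

theorem coe_padicHalf (hp : Odd p) : (padicHalf p : ℚ_[p]) = 1 / 2 := by
  have h := congrArg ((↑) : ℤ_[p] → ℚ_[p]) (two_mul_padicHalf hp)
  rw [PadicInt.coe_mul, PadicInt.coe_one] at h
  exact eq_one_div_of_mul_eq_one_right h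

theorem prime_mul_padicDash (x : ℤ_[p]) :
    (p : ℚ_[p]) * padicDash p x = x + leastResidue p (-x) :=
  mul_div_cancel₀ _ (Nat.cast_ne_zero.mpr (Fact.out : p.Prime).ne_zero)

theorem exists_two_mul_natCast_approx (hp : Odd p) (x : ℤ_[p]) : ∃ h t : ℕ,
    2 * h + leastResidue p (-x) = p * t ∧ (p : ℤ_[p]) ^ 3 ∣ x - 2 * h := by
  obtain ⟨h, hh⟩ := exists_natCast_pow_dvd_sub 3 (padicHalf p * x)
  have happrox : (p : ℤ_[p]) ^ 3 ∣ x - 2 * h := by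
    rw [show x - 2 * h = 2 * (padicHalf p * x - h) by
      linear_combination -x * two_mul_padicHalf hp]
    exact dvd_mul_of_dvd_right hh 2
  have hdvd : p ∣ 2 * h + leastResidue p (-x) := by
    rw [← padicInt_natCast_dvd_natCast]
    convert dvd_sub (dvd_add_leastResidue_neg x)
      ((dvd_pow_self (p : ℤ_[p]) three_ne_zero).trans happrox) using 1
    push_cast
    ring
  exact ⟨h, hdvd.choose, hdvd.choose_spec, happrox⟩

theorem intCast_mem_padicPow_zero (z : ℤ) : (z : ℚ_[p]) ∈ padicPow p 0 := by
  exact_mod_cast coe_mem_padicPow_zero (z : ℤ_[p])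

theorem prime_mul_padicDash_sub_mem {h t : ℕ} (hh : 2 * h + leastResidue p (-x) = p * t)
    (hx : (p : ℤ_[p]) ^ r ∣ x - 2 * h) :
    (p : ℚ_[p]) * padicDash p x - p * t ∈ padicPow p r := by
  have hh' : (2 * h + leastResidue p (-x) : ℚ_[p]) = p * t := by exact_mod_cast hh
  rw [prime_mul_padicDash, ← hh', add_sub_add_right_eq_sub]
  exact_mod_cast coe_mem_padicPow_iff.mpr hx

theorem padicCongr_truncHypergeom_of_approx (hp : Odd p) {h : ℕ} {c c' : ℚ_[p]}
    (hx : (p : ℤ_[p]) ^ r ∣ x - 2 * h) (hc' : c' ∈ padicPow p 0) (hc : c - c' ∈ padicPow p r)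
    (hsum : wellPoisedSum (2 * h : ℚ_[p]) 0 p - c' * dixonG p (2 * h) ∈ padicPow p r) :
    PadicCongr p r (truncHypergeom [(x : ℚ_[p]), (x : ℚ_[p]), (x : ℚ_[p])] [1, 1] 1 (p - 1))
      (c * dixonG p x) := by
  have htrunc := truncHypergeom_sub_mem hx
  have hcoe : ((2 * h : ℤ_[p]) : ℚ_[p]) = 2 * h := by norm_cast
  rw [truncHypergeom_eq_wellPoisedSum ((2 * h : ℤ_[p]) : ℚ_[p]),
    Nat.sub_add_cancel (Fact.out : p.Prime).one_le, hcoe] at htrunc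
  have hG := mul_mem_padicPow_right hc' (dixonG_sub_mem hp hx)
  have hcoef := mul_mem_padicPow_left hc (dixonG_mem_padicPow_zero hp x)
  rw [padicCongr_iff]
  convert sub_mem (add_mem htrunc hsum) (add_mem hG hcoef) using 1
  ring

theorem padicCongr_truncHypergeom_of_even (hp : Odd p) (hx : IsUnit x)
    (hn : Even (leastResidue p (-x))) :
    PadicCongr p 3 (truncHypergeom [(x : ℚ_[p]), (x : ℚ_[p]), (x : ℚ_[p])] [1, 1] 1 (p - 1))
      ((if 2 / 3 * p ≤ (leastResidue p (-x) : ℚ) then p * (2 - 3 * padicDash p x) else 2) *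
        dixonG p x) := by
  obtain ⟨h, t, hh, hxh⟩ := exists_two_mul_natCast_approx hp x
  have hdash := prime_mul_padicDash_sub_mem hh hxh
  have hpos := leastResidue_neg_pos hx
  have hlt := leastResidue_lt (-x)
  generalize leastResidue p (-x) = n at *
  obtain ⟨m, rfl⟩ := hn.exists_two_nsmul
  rw [smul_eq_mul] at *
  have hiff : 2 / 3 * p ≤ ((2 * m : ℕ) : ℚ) ↔ p ≤ 3 * m := by
    rw [← Nat.cast_le (α := ℚ)]
    push_cast
    constructor <;> intro <;> linarith
  rw [if_congr hiff rfl rfl]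
  refine padicCongr_truncHypergeom_of_approx hp hxh ?_ ?_
    (wellPoisedSum_two_mul_sub_mem_of_even hp (by lia) hlt hh)
  · split_ifs
    · exact_mod_cast intCast_mem_padicPow_zero (p * (2 - 3 * t))
    · exact_mod_cast intCast_mem_padicPow_zero 2
  · split_ifs
    · convert mul_mem_padicPow_right (intCast_mem_padicPow_zero (-3)) hdash using 1
      push_cast
      ring
    · rw [sub_self]
      exact zero_mem _

theorem padicCongr_truncHypergeom_of_odd (hp : Odd p) (hn : Odd (leastResidue p (-x))) :
    PadicCongr p 3 (truncHypergeom [(x : ℚ_[p]), (x : ℚ_[p]), (x : ℚ_[p])] [1, 1] 1 (p - 1))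
      ((if 1 / 3 * p ≤ (leastResidue p (-x) : ℚ) then
          1 / 2 * p ^ 2 * padicDash p x * (1 - 3 * padicDash p x) else p * padicDash p x) *
        dixonG p x) := by
  obtain ⟨h, t, hh, hxh⟩ := exists_two_mul_natCast_approx hp x
  have hdash := prime_mul_padicDash_sub_mem hh hxh
  have hlt := leastResidue_lt (-x)
  have hdash₀ : (p : ℚ_[p]) * padicDash p x ∈ padicPow p 0 := by
    rw [prime_mul_padicDash]
    exact add_mem (coe_mem_padicPow_zero x) (natCast_mem_padicPow_zero _)
  generalize leastResidue p (-x) = n at *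
  have hiff : 1 / 3 * p ≤ (n : ℚ) ↔ p ≤ 3 * n := by
    rw [← Nat.cast_le (α := ℚ)]
    push_cast
    constructor <;> intro <;> linarith
  have hhalf : (1 / 2 : ℚ_[p]) ∈ padicPow p 0 := coe_padicHalf hp ▸ coe_mem_padicPow_zero _
  rw [if_congr hiff rfl rfl]
  refine padicCongr_truncHypergeom_of_approx hp hxh ?_ ?_
    (wellPoisedSum_two_mul_sub_mem_of_odd hp hn hlt hh)
  · split_ifs
    · convert mul_mem_padicPow_right hhalf (intCast_mem_padicPow_zero (p ^ 2 * t * (1 - 3 * t)))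
        using 1
      push_cast
      ring
    · exact_mod_cast natCast_mem_padicPow_zero (p * t)
  · split_ifs
    · have hcofactor := mul_mem_padicPow_right hhalf (sub_mem (natCast_mem_padicPow_zero p)
        (mul_mem_padicPow_right (natCast_mem_padicPow_zero 3)
          (add_mem hdash₀ (natCast_mem_padicPow_zero (p * t)))))
      convert mul_mem_padicPow_left hdash hcofactor using 1
      push_cast
      ring
    · exact hdash

end Transfer

theorem theorem5p1 (p : ℕ) [Fact p.Prime] (hp : Odd p) (α : ℤ_[p]) (hα : IsUnit α) :
    (Even (leastResidue p (-α)) ∧ (leastResidue p (-α) : ℚ) < 2 / 3 * p →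
      PadicCongr p 3
        (truncHypergeom [(α : ℚ_[p]), (α : ℚ_[p]), (α : ℚ_[p])] [1, 1] 1 (p - 1))
        (2 * dixonG p α)) ∧
    (Even (leastResidue p (-α)) ∧ 2 / 3 * p ≤ (leastResidue p (-α) : ℚ) →
      PadicCongr p 3
        (truncHypergeom [(α : ℚ_[p]), (α : ℚ_[p]), (α : ℚ_[p])] [1, 1] 1 (p - 1))
        (p * (2 - 3 * padicDash p α) * dixonG p α)) ∧
    (Odd (leastResidue p (-α)) ∧ (leastResidue p (-α) : ℚ) < 1 / 3 * p →
      PadicCongr p 3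
        (truncHypergeom [(α : ℚ_[p]), (α : ℚ_[p]), (α : ℚ_[p])] [1, 1] 1 (p - 1))
        (p * padicDash p α * dixonG p α)) ∧
    (Odd (leastResidue p (-α)) ∧ 1 / 3 * p ≤ (leastResidue p (-α) : ℚ) →
      PadicCongr p 3
        (truncHypergeom [(α : ℚ_[p]), (α : ℚ_[p]), (α : ℚ_[p])] [1, 1] 1 (p - 1))
        (1 / 2 * p ^ 2 * padicDash p α * (1 - 3 * padicDash p α) * dixonG p α)) := by
  refine ⟨fun ⟨hn, hlt⟩ => ?_, fun ⟨hn, hle⟩ => ?_, fun ⟨hn, hlt⟩ => ?_, fun ⟨hn, hle⟩ => ?_⟩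
  · simpa only [if_neg hlt.not_ge] using padicCongr_truncHypergeom_of_even hp hα hn
  · simpa only [if_pos hle] using padicCongr_truncHypergeom_of_even hp hα hn
  · simpa only [if_neg hlt.not_ge] using padicCongr_truncHypergeom_of_odd hp hn
  · simpa only [if_pos hle] using padicCongr_truncHypergeom_of_odd hp hn
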